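/- Let $(M,g)$ be a $4$-dimensional Riemannian spin manifold (without boundary) with spinor bundle $\Sigma M$ (of complex rank $4$), Levi-Civita connection $\nabla^g$, Riemannian volume form $\omega^g$ and scalar curvature $R^g$. Let $V$ be a smooth vector field and $T$ a smooth $3$-form on $M$. Use the convention $X\cdot Y+Y\cdot X=-2g(X,Y)$ for Clifford multiplication, let $\theta^{i_1}\wedge\dots\wedge\theta^{i_k}$ act on spinors as $e_{i_1}\cdots e_{i_k}$ (for an orthonormal frame $e_i$ with dual coframe $\theta^i$), and for $k$-tensors put $\langle P,Q\rangle=\sum_{i_1,\dots,i_k}P(e_{i_1},\dots,e_{i_k})\,Q(e_{i_1},\dots,e_{i_k})$, $\|P\|^2=\langle P,P\rangle$. For a connection $\nabla$ on $TM$ with curvature $\operatorname{Riem}(X,Y)Z=\nabla_X\nabla_YZ-\nabla_Y\nabla_XZ-\nabla_{[X,Y]}Z$, the scalar curvature is $\sum_{i,j}\langle\operatorname{Riem}(e_i,e_j)e_j,e_i\rangle$. Let $\widetilde R$ be the scalar curvature of the connection $$\widetilde\nabla_XY=\nabla^g_XY+3\big(\langle X,Y\rangle V-\langle V,Y\rangle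 X\big)+3\,T(X,Y,\cdot)^\sharp ,$$ let $\widetilde C_H$ be the $4$-form (the Holst term of $\widetilde\nabla$) $$\widetilde C_H=18\,dT-18\,\langle T,\ast V^\flat\rangle\,\omega^g ,$$ and let $E$ be the endomorphism field of $\Sigma M$ (the potential in the Lichnerowicz formula $D^*D=\Delta-E$ for the Dirac operator $D\psi=D^g\psi+\tfrac32T\cdot\psi-\tfrac32V\cdot\psi$) $$E=\Big(-\tfrac14R^g+\tfrac34\|T\|^2-\tfrac32\operatorname{div}^g(V)+\tfrac92|V|^2\Big)\operatorname{id}_\Sigma-\tfrac32\,dT-9\,T\cdot V-9\,(V\lrcorner T),$$ in which forms and vectors act by Clifford multiplication. Then at every point of $M$ the traces over the spinor bundle are $$\operatorname{tr}_\Sigma(E)=-\tfrac23R^g-\tfrac13\widetilde R,$$ $$\operatorname{tr}_\Sigma(E^2)=\tfrac1{36}\big(2R^g+\widetilde R\big)^2+\tfrac38\|dT\|^2-162\,\|V\lrcorner T\|^2+54\,|V|^2\|T\|^2-18\,\langle V\lrcorner dT,T\rangle,$$ $$\operatorname{tr}_\Sigma(E\,\omega^g)=-\tfrac1{72}\langle\widetilde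 C_H,\omega^g\rangle,$$ $$\operatorname{tr}_\Sigma(E^2\,\omega^g)=\tfrac1{432}\big(2R^g+\widetilde R\big)\langle\widetilde C_H,\omega^g\rangle .$$ -/

import Mathlib

open Manifold Bundle
open scoped ContDiff

noncomputable section

/-! ## Multilinear algebra in an oriented 4-dimensional Euclidean space -/

section Pointwise

variable {W : Type*} [NormedAddCommGroup W] [InnerProductSpace ℝ W]
  (b : OrthonormalBasis (Fin 4) ℝ W)

/-- The natural scalar product of `(k,0)`-tensors,
`⟨P, Q⟩ = ∑ P(e_{i₁}, …, e_{iₖ}) Q(e_{i₁}, …, e_{iₖ})`, over all index tuples, for an orthonormal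
basis `e = b`. -/
def tensorInner {k : ℕ} (P Q : (Fin k → W) → ℝ) : ℝ :=
  ∑ i : Fin k → Fin 4, P (fun l => b (i l)) * Q (fun l => b (i l))

/-- The volume form of the orientation for which the orthonormal basis `b` is positively oriented:
`ω(e₁, e₂, e₃, e₄) = 1`. -/
def volForm : W [⋀^Fin 4]→ₗ[ℝ] ℝ := b.toBasis.det

/-- The interior product `v ⌟ α = α(v, ·, …, ·)`. -/
def interiorProd {k : ℕ} (v : W) (α : W [⋀^Fin (k + 1)]→ₗ[ℝ] ℝ) : W [⋀^Fin k]→ₗ[ℝ] ℝ :=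
  α.curryLeft v

/-- The 1-form `v^♭ = ⟨v, ·⟩`. -/
def flat (v : W) : W →ₗ[ℝ] ℝ := innerₗ W v

/-- The Hodge star of a 1-form in dimension 4: `∗α = ∑ₐ α(eₐ) (eₐ ⌟ ω)`.  In particular
`∗ e₁^♭ = e₂^♭ ∧ e₃^♭ ∧ e₄^♭`, so that `α ∧ ∗β = ⟨α, β⟩ ω`. -/
def hodgeOneForm (α : W →ₗ[ℝ] ℝ) : W [⋀^Fin 3]→ₗ[ℝ] ℝ :=
  ∑ a, α (b a) • interiorProd (b a) (volForm b)

/-- The vector `f^♯`, characterised by `⟨f^♯, w⟩ = f w` for all `w`. -/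
def sharp [FiniteDimensional ℝ W] (f : W →L[ℝ] ℝ) : W :=
  haveI := FiniteDimensional.complete ℝ W
  (InnerProductSpace.toDual ℝ W).symm f

theorem inner_sharp [FiniteDimensional ℝ W] (f : W →L[ℝ] ℝ) (w : W) :
    inner ℝ (sharp f) w = f w := by
  have := FiniteDimensional.complete ℝ W
  simp [sharp]

theorem alt_slot {W : Type*} (X Y Z A : W) :
    Function.update ![X, Y, Z] 0 A = ![A, Y, Z] ∧ Function.update ![X, Y, Z] 1 A = ![X, A, Z] ∧
      Function.update ![X, Y, Z] 2 A = ![X, Y, A] := by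
  refine ⟨?_, ?_, ?_⟩ <;> (ext i; fin_cases i <;> rfl)

/-- The linear form `τ(X, Y, ·)`. -/
def fillTwo (τ : W [⋀^Fin 3]→L[ℝ] ℝ) (X Y : W) : W →L[ℝ] ℝ :=
  τ.toContinuousMultilinearMap.toContinuousLinearMap ![X, Y, 0] 2

theorem fillTwo_apply (τ : W [⋀^Fin 3]→L[ℝ] ℝ) (X Y Z : W) : fillTwo τ X Y Z = τ ![X, Y, Z] := by
  simp [fillTwo, (alt_slot X Y 0 Z).2.2]

/-- The bilinear map `(Y, X) ↦ ⟨X, Y⟩ v - ⟨v, Y⟩ X + τ(X, Y, ·)^♯`. -/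
def torsionBilin [FiniteDimensional ℝ W] (v : W) (τ : W [⋀^Fin 3]→L[ℝ] ℝ) : W →ₗ[ℝ] W →ₗ[ℝ] W :=
  LinearMap.mk₂ ℝ
    (fun Y X => inner ℝ X Y • v - inner ℝ v Y • X + sharp (fillTwo τ X Y))
    (by
      intro Y Y' X
      refine ext_inner_right ℝ fun Z => ?_
      have := τ.map_update_add ![X, Y, Z] 1 Y Y'
      simp only [(alt_slot X Y Z _).2.1] at this
      simp [inner_add_left, inner_sub_left, inner_smul_left, inner_add_right, inner_sharp,
        fillTwo_apply, this]
      ring)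
    (by
      intro c Y X
      refine ext_inner_right ℝ fun Z => ?_
      have := τ.map_update_smul ![X, Y, Z] 1 c Y
      simp only [(alt_slot X Y Z _).2.1] at this
      simp [inner_add_left, inner_sub_left, inner_smul_left, inner_smul_right, inner_sharp,
        fillTwo_apply, this]
      ring)
    (by
      intro Y X X'
      refine ext_inner_right ℝ fun Z => ?_
      have := τ.map_update_add ![X, Y, Z] 0 X X'
      simp only [(alt_slot X Y Z _).1] at this
      simp [inner_add_left, inner_sub_left, inner_smul_left, inner_sharp,
        fillTwo_apply, this]
      ring)
    (by
      intro c Y X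
      refine ext_inner_right ℝ fun Z => ?_
      have := τ.map_update_smul ![X, Y, Z] 0 c X
      simp only [(alt_slot X Y Z _).1] at this
      simp [inner_add_left, inner_sub_left, inner_smul_left, inner_sharp,
        fillTwo_apply, this]
      ring)

/-- The same map as a continuous bilinear map. -/
def torsionTensor [FiniteDimensional ℝ W] (v : W) (τ : W [⋀^Fin 3]→L[ℝ] ℝ) : W →L[ℝ] W →L[ℝ] W :=
  LinearMap.toContinuousLinearMap
    ((LinearMap.toContinuousLinearMap : (W →ₗ[ℝ] W) ≃ₗ[ℝ] W →L[ℝ] W).toLinearMap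
      ∘ₗ torsionBilin v τ)

end Pointwise

/-! ## The group `Spin(4)` and the spinor representation -/

/-- The quadratic form `-|v|²` of Euclidean `ℝ⁴`; in its Clifford algebra
`v · w + w · v = -2 ⟨v, w⟩`. -/
def negQ : QuadraticForm ℝ (Fin 4 → ℝ) := QuadraticMap.weightedSumSquares ℝ (fun _ => (-1 : ℝ))

/-- The matrices by which the standard basis vectors of `ℝ⁴` act on the spinor module `ℂ⁴`. -/
def gammaMat : Fin 4 → Matrix (Fin 4) (Fin 4) ℂ :=
  ![!![0, 0, 1, 0; 0, 0, 0, 1; -1, 0, 0, 0; 0, -1, 0, 0],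
    !![0, 0, 0, Complex.I; 0, 0, Complex.I, 0; 0, Complex.I, 0, 0; Complex.I, 0, 0, 0],
    !![0, 0, 0, 1; 0, 0, -1, 0; 0, 1, 0, 0; -1, 0, 0, 0],
    !![0, 0, Complex.I, 0; 0, 0, 0, -Complex.I; Complex.I, 0, 0, 0; 0, -Complex.I, 0, 0]]

/-- Clifford multiplication by vectors of `ℝ⁴` on `ℂ⁴`. -/
def gammaLin : (Fin 4 → ℝ) →ₗ[ℝ] Matrix (Fin 4) (Fin 4) ℂ :=
  ∑ a, (LinearMap.proj a : (Fin 4 → ℝ) →ₗ[ℝ] ℝ).smulRight (gammaMat a)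

theorem gammaLin_sq (v : Fin 4 → ℝ) :
    gammaLin v * gammaLin v = algebraMap ℝ (Matrix (Fin 4) (Fin 4) ℂ) (negQ v) := by
  ext i j
  fin_cases i <;> fin_cases j <;>
    simp [gammaLin, gammaMat, negQ, Matrix.mul_apply, Fin.sum_univ_four,
      QuadraticMap.weightedSumSquares_apply, Matrix.algebraMap_matrix_apply] <;>
    ring_nf <;> simp [Complex.I_sq] <;> ring

/-- The irreducible complex module `ℂ⁴` of the Clifford algebra of Euclidean `ℝ⁴`. -/
def spinorRep : CliffordAlgebra negQ →ₐ[ℝ] Matrix (Fin 4) (Fin 4) ℂ :=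
  CliffordAlgebra.lift negQ ⟨gammaLin, gammaLin_sq⟩

/-- The model fibre of the spinor bundle. -/
abbrev Spinor4 : Type := EuclideanSpace ℂ (Fin 4)

/-! ## Riemannian 4-manifolds -/

/-- The model space of 4-dimensional manifolds. -/
abbrev E4 : Type := EuclideanSpace ℝ (Fin 4)

section Manifold

variable {M : Type*} [TopologicalSpace M] [ChartedSpace E4 M]

/-- A `k`-form near `p` in the chart at `p`: its pull-back along the inverse of the chart. -/
def formInChart {k : ℕ} (T : (x : M) → TangentSpace (𝓡 4) x [⋀^Fin k]→L[ℝ] ℝ) (p : M) (y : E4) :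
    E4 [⋀^Fin k]→L[ℝ] ℝ :=
  (T ((extChartAt (𝓡 4) p).symm y)).compContinuousLinearMap
    (mfderiv 𝓘(ℝ, E4) (𝓡 4) (extChartAt (𝓡 4) p).symm y)

/-- A differential form is smooth if it is so in the charts. -/
def IsSmoothForm {k : ℕ} (T : (x : M) → TangentSpace (𝓡 4) x [⋀^Fin k]→L[ℝ] ℝ) : Prop :=
  ∀ p : M, ContDiffOn ℝ ∞ (formInChart T p) (extChartAt (𝓡 4) p).target

/-- The exterior derivative of a differential form, computed at `p` in the chart at `p`. -/
def exteriorDerivative {k : ℕ} (T : (x : M) → TangentSpace (𝓡 4) x [⋀^Fin k]→L[ℝ] ℝ) (p : M) :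
    TangentSpace (𝓡 4) p [⋀^Fin (k + 1)]→L[ℝ] ℝ :=
  (extDeriv (formInChart T p) (extChartAt (𝓡 4) p p)).compContinuousLinearMap
    (mfderiv (𝓡 4) 𝓘(ℝ, E4) (extChartAt (𝓡 4) p) p)

/-- A smooth vector field. -/
def IsSmoothVectorField [IsManifold (𝓡 4) ∞ M] (V : (x : M) → TangentSpace (𝓡 4) x) : Prop :=
  ContMDiff (𝓡 4) (𝓡 4).tangent ∞ (fun x => (⟨x, V x⟩ : TangentBundle (𝓡 4) M))

variable [IsManifold (𝓡 4) ∞ M]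

/-- Connections on the tangent bundle.  Mathlib writes `D Y x (X x)` for `(D_X Y)(x)`. -/
abbrev TangentConnection (M : Type*) [TopologicalSpace M] [ChartedSpace E4 M]
    [IsManifold (𝓡 4) ∞ M] : Type _ :=
  CovariantDerivative (𝓡 4) E4 (fun x : M => TangentSpace (𝓡 4) x)

/-- The curvature `Riem(u, v)w = D_X D_Y Z - D_Y D_X Z - D_{[X,Y]} Z` at `x`, where `X, Y, Z` are
the extensions of `u, v, w` to vector fields that are constant in the chart at `x`.  By
tensoriality the choice of the extensions is irrelevant. -/
def riemann (D : TangentConnection M) (x : M) (u v w : TangentSpace (𝓡 4) x) :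
    TangentSpace (𝓡 4) x :=
  let X : (y : M) → TangentSpace (𝓡 4) y := FiberBundle.extend E4 u
  let Y : (y : M) → TangentSpace (𝓡 4) y := FiberBundle.extend E4 v
  let Z : (y : M) → TangentSpace (𝓡 4) y := FiberBundle.extend E4 w
  D (fun y => D Z y (Y y)) x (X x) - D (fun y => D Z y (X y)) x (Y x)
    - D Z x (VectorField.mlieBracket (𝓡 4) X Y x)

variable [RiemannianBundle (fun x : M => TangentSpace (𝓡 4) x)]

/-- The scalar curvature `∑_{i,j} ⟨Riem(eᵢ, eⱼ)eⱼ, eᵢ⟩`, that is `∑ⱼ ric(eⱼ, eⱼ)` with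
`ric(X, Y) = ∑ᵢ ⟨Riem(eᵢ, X)Y, eᵢ⟩`, for an orthonormal basis `e = b` of the tangent space. -/
def scalarCurvature (D : TangentConnection M) (x : M)
    (b : OrthonormalBasis (Fin 4) ℝ (TangentSpace (𝓡 4) x)) : ℝ :=
  ∑ i, ∑ j, inner ℝ (riemann D x (b i) (b j) (b j)) (b i)

/-- The divergence `∑ᵢ ⟨D_{eᵢ} V, eᵢ⟩`, for an orthonormal basis `e = b` of the tangent space. -/
def divergence (D : TangentConnection M) (V : (x : M) → TangentSpace (𝓡 4) x) (x : M)
    (b : OrthonormalBasis (Fin 4) ℝ (TangentSpace (𝓡 4) x)) : ℝ :=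
  ∑ i, inner ℝ (D V x (b i)) (b i)

/-- A connection on the tangent bundle is the Levi-Civita connection if it is metric and
torsion free. -/
def IsLeviCivita [IsContMDiffRiemannianBundle (𝓡 4) ∞ E4 (fun x : M => TangentSpace (𝓡 4) x)]
    (D : TangentConnection M) : Prop :=
  haveI : IsContMDiffRiemannianBundle (𝓡 4) 1 E4 (fun x : M => TangentSpace (𝓡 4) x) :=
    IsContMDiffRiemannianBundle.of_le (n := ∞) (by norm_cast)
  D.IsMetricCompatible ∧ D.torsion = 0

/-- The orthogonal connection
`D_X Y + ⟨X, Y⟩ V - ⟨V, Y⟩ X + T(X, Y, ·)^♯` obtained from a connection `D` (the Levi-Civita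
connection), a vector field `V` and a 3-form `T`. -/
def orthogonalConnection (D : TangentConnection M) (V : (x : M) → TangentSpace (𝓡 4) x)
    (T : (x : M) → TangentSpace (𝓡 4) x [⋀^Fin 3]→L[ℝ] ℝ) : TangentConnection M :=
  D.addOneForm fun x =>
    haveI : FiniteDimensional ℝ (TangentSpace (𝓡 4) x) := inferInstanceAs (FiniteDimensional ℝ E4)
    torsionTensor (V x) (T x)

/-- The modified connection
`D_X Y + 3 (⟨X, Y⟩ V - ⟨V, Y⟩ X) + 3 T(X, Y, ·)^♯`. -/
def modifiedConnection (D : TangentConnection M) (V : (x : M) → TangentSpace (𝓡 4) x)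
    (T : (x : M) → TangentSpace (𝓡 4) x [⋀^Fin 3]→L[ℝ] ℝ) : TangentConnection M :=
  orthogonalConnection D (fun x => (3 : ℝ) • V x) (fun x => (3 : ℝ) • T x)

/-! ## Spin structures and the spinor bundle -/

/-- A spin structure on a Riemannian 4-manifold, presented by local data: a cover by open sets
`baseSet i`, on each of them a smooth orthonormal frame, and smooth `Spin(4)`-valued functions on
the overlaps that satisfy the cocycle condition and lift the transition functions of the frames.
(The frames then induce an orientation of the manifold.) -/
structure SpinStructure (M : Type*) [TopologicalSpace M] [ChartedSpace E4 M]
    [IsManifold (𝓡 4) ∞ M] [RiemannianBundle (fun x : M => TangentSpace (𝓡 4) x)]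
    (ι : Type*) where
  baseSet : ι → Set M
  isOpen_baseSet : ∀ i, IsOpen (baseSet i)
  indexAt : M → ι
  mem_baseSet_at : ∀ x, x ∈ baseSet (indexAt x)
  /-- the local frames -/
  frame : ι → Fin 4 → (x : M) → TangentSpace (𝓡 4) x
  smooth_frame : ∀ i a, ContMDiffOn (𝓡 4) (𝓡 4).tangent ∞
    (fun x => (⟨x, frame i a x⟩ : TangentBundle (𝓡 4) M)) (baseSet i)
  orthonormal_frame : ∀ i, ∀ x ∈ baseSet i, Orthonormal ℝ (fun a => frame i a x)
  /-- the lifted transition functions -/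
  lift : ι → ι → M → spinGroup negQ
  smooth_lift : ∀ i j k l, ContMDiffOn (𝓡 4) 𝓘(ℝ, ℂ) ∞
    (fun x => spinorRep (lift i j x : CliffordAlgebra negQ) k l) (baseSet i ∩ baseSet j)
  lift_comp : ∀ i j k, ∀ x ∈ baseSet i ∩ baseSet j ∩ baseSet k,
    lift j k x * lift i j x = lift i k x
  /-- conjugation by `lift i j x` is the change of coordinates from the `i`-th to the `j`-th
  frame -/
  lift_covers : ∀ i j, ∀ x ∈ baseSet i ∩ baseSet j, ∀ v : TangentSpace (𝓡 4) x,
    (lift i j x : CliffordAlgebra negQ)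
        * CliffordAlgebra.ι negQ (fun a => inner ℝ (frame i a x) v)
      = CliffordAlgebra.ι negQ (fun a => inner ℝ (frame j a x) v)
        * (lift i j x : CliffordAlgebra negQ)

namespace SpinStructure

variable {ι : Type*} (S : SpinStructure M ι)

/-- The chosen positively oriented orthonormal basis of the tangent space at `x`. -/
def frameBasis (x : M) : OrthonormalBasis (Fin 4) ℝ (TangentSpace (𝓡 4) x) :=
  OrthonormalBasis.mk (v := fun a => S.frame (S.indexAt x) a x)
    (S.orthonormal_frame _ x (S.mem_baseSet_at x))
    (by
      have h : Module.finrank ℝ (TangentSpace (𝓡 4) x) = 4 :=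
        (finrank_euclideanSpace_fin : Module.finrank ℝ E4 = 4)
      exact ((S.orthonormal_frame _ x
        (S.mem_baseSet_at x)).linearIndependent.span_eq_top_of_card_eq_finrank
          (by simp [h])).ge)

/-- The spinor bundle `ΣM`, glued from trivial bundles with fibre `ℂ⁴` by the spinor
representation of the lifted transition functions. -/
def spinorBundle : VectorBundleCore ℂ M Spinor4 ι where
  baseSet := S.baseSet
  isOpen_baseSet := S.isOpen_baseSet
  indexAt := S.indexAt
  mem_baseSet_at := S.mem_baseSet_at
  coordChange i j x :=
    Matrix.toEuclideanCLM (𝕜 := ℂ) (spinorRep (S.lift i j x : CliffordAlgebra negQ))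
  coordChange_self i x hx v := by
    have h := S.lift_comp i i i x ⟨⟨hx, hx⟩, hx⟩
    have h1 : S.lift i i x = 1 := by simpa using h
    simp [h1]
  continuousOn_coordChange i j := by
    have hc : Continuous (fun A : Matrix (Fin 4) (Fin 4) ℂ =>
        (Matrix.toEuclideanCLM (𝕜 := ℂ) A : Spinor4 →L[ℂ] Spinor4)) :=
      LinearMap.continuous_of_finiteDimensional
        ((Matrix.toEuclideanCLM (𝕜 := ℂ) (n := Fin 4)).toAlgEquiv.toLinearMap)
    refine hc.comp_continuousOn ?_
    refine continuousOn_pi.2 fun k => continuousOn_pi.2 fun l => ?_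
    exact (S.smooth_lift i j k l).continuousOn
  coordChange_comp i j k x hx v := by
    rw [← S.lift_comp i j k x hx]
    simp

/-- The fibre of the spinor bundle at `x`. -/
abbrev Spinors (x : M) : Type := S.spinorBundle.Fiber x

/-- Clifford multiplication by a tangent vector on the fibre of the spinor bundle.  The fibre at
`x` is `ℂ⁴` in the trivialization given by the frame of `S.frameBasis x`. -/
def cliffordVec {x : M} (v : TangentSpace (𝓡 4) x) : Module.End ℂ (S.Spinors x) :=
  (Matrix.toEuclideanLin (gammaLin fun a => inner ℝ (S.frameBasis x a) v) :
    Spinor4 →ₗ[ℂ] Spinor4)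

/-- Clifford multiplication by a `k`-form: `e_{i₁}^♭ ∧ … ∧ e_{iₖ}^♭` acts as `e_{i₁} ⋯ e_{iₖ}`. As
`α = (1/k!) ∑ α(e_{i₁}, …, e_{iₖ}) e_{i₁}^♭ ∧ … ∧ e_{iₖ}^♭`, the sum over all index tuples has to
be divided by `k!`. -/
def cliffordForm {x : M} {k : ℕ} (α : TangentSpace (𝓡 4) x [⋀^Fin k]→ₗ[ℝ] ℝ) :
    Module.End ℂ (S.Spinors x) :=
  ((Nat.factorial k : ℂ))⁻¹ • ∑ i : Fin k → Fin 4,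
    ((α (fun l => S.frameBasis x (i l)) : ℝ) : ℂ) •
      (List.ofFn fun l => S.cliffordVec (S.frameBasis x (i l))).prod

/-- The Riemannian volume form at `x`. -/
def vol (x : M) : TangentSpace (𝓡 4) x [⋀^Fin 4]→ₗ[ℝ] ℝ := volForm (S.frameBasis x)

variable (D : TangentConnection M) (V : (x : M) → TangentSpace (𝓡 4) x)
  (T : (x : M) → TangentSpace (𝓡 4) x [⋀^Fin 3]→L[ℝ] ℝ)

/-- The potential
`E = (-R/4 + 3‖T‖²/4 - 3 div(V)/2 + 9|V|²/2) id - (3/2) dT - 9 T · V - 9 (V ⌟ T)`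
at `x`, where forms and vectors act by Clifford multiplication, `D` is the Levi-Civita connection
and `R` its scalar curvature. -/
def potential (x : M) : Module.End ℂ (S.Spinors x) :=
  let b := S.frameBasis x
  let τ := (T x).toAlternatingMap
  let dτ := (exteriorDerivative T x).toAlternatingMap
  ((-(1 / 4) * scalarCurvature D x b + 3 / 4 * tensorInner b τ τ
      - 3 / 2 * divergence D V x b + 9 / 2 * inner ℝ (V x) (V x) : ℝ) : ℂ) •
      (1 : Module.End ℂ (S.Spinors x))
    - (3 / 2 : ℂ) • S.cliffordForm dτ
    - (9 : ℂ) • (S.cliffordForm τ * S.cliffordVec (V x))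
    - (9 : ℂ) • S.cliffordForm (interiorProd (V x) τ)

/-- The Holst term `18 dT - 18 ⟨T, ∗V^♭⟩ ω` of the modified connection, at `x`. -/
def holstTerm (x : M) : TangentSpace (𝓡 4) x [⋀^Fin 4]→ₗ[ℝ] ℝ :=
  (18 : ℝ) • (exteriorDerivative T x).toAlternatingMap
    - (18 * tensorInner (S.frameBasis x) (T x)
        (hodgeOneForm (S.frameBasis x) (flat (V x)))) • S.vol x

end SpinStructure

end Manifold

end

open Manifold Bundle
open scoped ContDiff

noncomputable section

/-! ### Forms acting through Clifford generators, by recursion on the degree. -/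

section CliffordForms

variable {W : Type*} [NormedAddCommGroup W] [InnerProductSpace ℝ W]
  (b : OrthonormalBasis (Fin 4) ℝ W)

/-! In dimension 4 the potential has only two components: E = f · 1 + c · ω, where ω = e₀e₁e₂e₃ is
the volume element. Indeed dT is a 4-form, hence a multiple of ω, and T · V = T ∧ V^♭ - V ⌟ T in the
Clifford algebra, so that T · V and V ⌟ T add up to the 4-form T ∧ V^♭ (`potential_eq`). Since ω² =
1, tr ω = 0 and tr 1 = 4, the four traces are 4f, 4(f² + c²), 4c and 8fc (`trace_potential`).

It remains to recognise f and c. For c this is linear algebra. Write d and w for the coefficients of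
dT and T ∧ V^♭ with respect to ω; then c = -(3/2)d - 9w. The Holst term is -12c ω, and the identity
|V ∧ T|² + |V ⌟ T|² = |V|²|T|² (norms of forms) turns 4c² into the stated tensor norms.

For f one needs the scalar curvature of the connection D + A with torsion data (V, T), which is R +
6 div V - 6|V|² - ‖T‖² (`IsLeviCivita.scalarCurvature_orthogonalConnection`); with 3V and 3T in
place of V and T it gives 2R + R̃ = -12f. Derivatives of T do not occur in it: T drops out by
antisymmetry from ⟨A(Y)Y, X⟩ and ⟨A(Y)X, X⟩, the only products that have to be differentiated. The
comparison of curvatures differentiates fields such as D_Y Y, whose differentiability follows from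
the Koszul formula (`IsLeviCivita.fieldDiffAt`). -/

theorem sum_fin_succ_tuple {β : Type*} [AddCommMonoid β] {k : ℕ} (f : (Fin (k + 1) → Fin 4) → β) :
    ∑ i, f i = ∑ a, ∑ j : Fin k → Fin 4, f (Fin.cons a j) := by
  rw [← Fintype.sum_prod_type']
  exact (Equiv.sum_comp (Fin.consEquiv fun _ => Fin 4) f).symm

theorem basis_cons_tuple {k : ℕ} (a : Fin 4) (j : Fin k → Fin 4) :
    (fun l => b ((Fin.cons a j : Fin (k + 1) → Fin 4) l)) =
      Matrix.vecCons (b a) (fun l => b (j l)) := by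
  funext l
  refine Fin.cases ?_ (fun l => ?_) l <;> simp

theorem tensorInner_zero (P Q : W [⋀^Fin 0]→ₗ[ℝ] ℝ) : tensorInner b P Q = P ![] * Q ![] := by
  simp [tensorInner, Subsingleton.elim _ ![]]

theorem tensorInner_succ {k : ℕ} (P Q : W [⋀^Fin (k + 1)]→ₗ[ℝ] ℝ) :
    tensorInner b P Q =
      ∑ a, tensorInner b (interiorProd (b a) P) (interiorProd (b a) Q) := by
  simp only [tensorInner, sum_fin_succ_tuple, basis_cons_tuple, interiorProd,
    AlternatingMap.curryLeft_apply_apply]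

/-- The action of a `k`-form in an algebra by means of the elements `G a` representing the
basis vectors. -/
def cliffordAction {A : Type*} [Ring A] [Algebra ℂ A] (G : Fin 4 → A) {k : ℕ}
    (α : W [⋀^Fin k]→ₗ[ℝ] ℝ) : A :=
  ((Nat.factorial k : ℂ))⁻¹ • ∑ i : Fin k → Fin 4,
    ((α (fun l => b (i l)) : ℝ) : ℂ) • (List.ofFn fun l => G (i l)).prod

variable {A : Type*} [Ring A] [Algebra ℂ A] (G : Fin 4 → A)

theorem cliffordAction_zero (α : W [⋀^Fin 0]→ₗ[ℝ] ℝ) :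
    cliffordAction b G α = ((α ![] : ℝ) : ℂ) • (1 : A) := by
  simp [cliffordAction, Subsingleton.elim _ ![]]

/-- The recursion k α = ∑ e_a · (e_a ⌟ α), valid because the first factor of each ordered product
can be split off. It allows degrees 2, 3 and 4 to be treated one after another, so that the 4⁴ index
tuples are never expanded at once. -/
theorem cliffordAction_succ {k : ℕ} (α : W [⋀^Fin (k + 1)]→ₗ[ℝ] ℝ) :
    cliffordAction b G α =
      ((k + 1 : ℕ) : ℂ)⁻¹ • ∑ a, G a * cliffordAction b G (interiorProd (b a) α) := by
  simp only [cliffordAction, sum_fin_succ_tuple, basis_cons_tuple, interiorProd,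
    AlternatingMap.curryLeft_apply_apply, Nat.factorial_succ, Nat.cast_mul, mul_inv,
    mul_smul_comm, Finset.mul_sum, ← Finset.smul_sum, mul_smul, List.ofFn_succ, List.prod_cons,
    Fin.cons_zero, Fin.cons_succ]

end CliffordForms

/-- The volume element squares to `1`. -/
theorem volume_element_sq {A : Type*} [Ring A] {G : Fin 4 → A}
    (hG : ∀ a c, a ≠ c → G a * G c = -(G c * G a))
    (hG2 : ∀ a, G a * G a = -1) :
    (G 0 * (G 1 * (G 2 * G 3))) * (G 0 * (G 1 * (G 2 * G 3))) = 1 := by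
  -- With an arbitrary tail `z` these rules sort right-nested products by index; equal neighbours
  -- then collapse from the right end by `hG2`.
  have h10 (z : A) : G 1 * (G 0 * z) = -(G 0 * (G 1 * z)) := by
    rw [← mul_assoc, hG 1 0 (by decide), neg_mul, mul_assoc]
  have h20 (z : A) : G 2 * (G 0 * z) = -(G 0 * (G 2 * z)) := by
    rw [← mul_assoc, hG 2 0 (by decide), neg_mul, mul_assoc]
  have h30 (z : A) : G 3 * (G 0 * z) = -(G 0 * (G 3 * z)) := by
    rw [← mul_assoc, hG 3 0 (by decide), neg_mul, mul_assoc]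
  have h21 (z : A) : G 2 * (G 1 * z) = -(G 1 * (G 2 * z)) := by
    rw [← mul_assoc, hG 2 1 (by decide), neg_mul, mul_assoc]
  have h31 (z : A) : G 3 * (G 1 * z) = -(G 1 * (G 3 * z)) := by
    rw [← mul_assoc, hG 3 1 (by decide), neg_mul, mul_assoc]
  have h32 (z : A) : G 3 * (G 2 * z) = -(G 2 * (G 3 * z)) := by
    rw [← mul_assoc, hG 3 2 (by decide), neg_mul, mul_assoc]
  simp only [mul_assoc, mul_neg, neg_neg, hG2, mul_one,
    h10, h20, h30, h21, h31, h32]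

/-! ### Forms of degree 2, 3 and 4 through their components with increasing indices. -/

section FormComponents

variable {W : Type*} [NormedAddCommGroup W] [InnerProductSpace ℝ W]
  (b : OrthonormalBasis (Fin 4) ℝ W)

theorem alternating_two_swap (β : W [⋀^Fin 2]→ₗ[ℝ] ℝ) (x y : W) : β ![y, x] = -β ![x, y] := by
  rw [← β.map_swap ![x, y] (i := 0) (j := 1) (by decide)]
  congr 1
  ext i
  fin_cases i <;> rfl

theorem alternating_three_swap (τ : W [⋀^Fin 3]→ₗ[ℝ] ℝ) (x y z : W) :
    τ ![y, x, z] = -τ ![x, y, z] ∧ τ ![x, z, y] = -τ ![x, y, z] := by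
  constructor
  · rw [← τ.map_swap ![x, y, z] (i := 0) (j := 1) (by decide)]
    congr 1; ext i; fin_cases i <;> rfl
  · rw [← τ.map_swap ![x, y, z] (i := 1) (j := 2) (by decide)]
    congr 1; ext i; fin_cases i <;> rfl

theorem alternating_four_swap (δ : W [⋀^Fin 4]→ₗ[ℝ] ℝ) (x y z w : W) :
    δ ![y, x, z, w] = -δ ![x, y, z, w] ∧ δ ![x, z, y, w] = -δ ![x, y, z, w] ∧
      δ ![x, y, w, z] = -δ ![x, y, z, w] := by
  refine ⟨?_, ?_, ?_⟩
  · rw [← δ.map_swap ![x, y, z, w] (i := 0) (j := 1) (by decide)]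
    congr 1; ext i; fin_cases i <;> rfl
  · rw [← δ.map_swap ![x, y, z, w] (i := 1) (j := 2) (by decide)]
    congr 1; ext i; fin_cases i <;> rfl
  · rw [← δ.map_swap ![x, y, z, w] (i := 2) (j := 3) (by decide)]
    congr 1; ext i; fin_cases i <;> rfl

theorem alternating_two_self (β : W [⋀^Fin 2]→ₗ[ℝ] ℝ) (x : W) : β ![x, x] = 0 := by
  have := alternating_two_swap β x x
  linarith

theorem alternating_three_self (τ : W [⋀^Fin 3]→ₗ[ℝ] ℝ) (x y : W) :
    τ ![x, x, y] = 0 ∧ τ ![y, x, x] = 0 := by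
  have h1 := (alternating_three_swap τ x x y).1
  have h2 := (alternating_three_swap τ y x x).2
  exact ⟨by linarith, by linarith⟩

theorem alternating_four_self (δ : W [⋀^Fin 4]→ₗ[ℝ] ℝ) (x y z : W) :
    δ ![x, x, y, z] = 0 ∧ δ ![y, x, x, z] = 0 ∧ δ ![y, z, x, x] = 0 := by
  have h1 := (alternating_four_swap δ x x y z).1
  have h2 := (alternating_four_swap δ y x x z).2.1
  have h3 := (alternating_four_swap δ y z x x).2.2
  exact ⟨by linarith, by linarith, by linarith⟩

theorem interiorProd_three (τ : W [⋀^Fin 3]→ₗ[ℝ] ℝ) (v x y : W) :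
    interiorProd v τ ![x, y] = τ ![v, x, y] := rfl

theorem interiorProd_four (δ : W [⋀^Fin 4]→ₗ[ℝ] ℝ) (v x y z : W) :
    interiorProd v δ ![x, y, z] = δ ![v, x, y, z] := rfl

theorem tensorInner_two (P Q : W [⋀^Fin 2]→ₗ[ℝ] ℝ) :
    tensorInner b P Q = ∑ i, ∑ j, P ![b i, b j] * Q ![b i, b j] := by
  simp only [tensorInner_succ, tensorInner_zero]
  rfl

theorem tensorInner_three (P Q : W [⋀^Fin 3]→ₗ[ℝ] ℝ) :
    tensorInner b P Q = ∑ i, ∑ j, ∑ k, P ![b i, b j, b k] * Q ![b i, b j, b k] := by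
  simp only [tensorInner_succ b P, tensorInner_two, interiorProd_three]

/-- The factor 6 = 3! counts the orderings of an index triple; the two signs of a reordering cancel
in the product. -/
theorem tensorInner_three_eq (P Q : W [⋀^Fin 3]→ₗ[ℝ] ℝ) :
    tensorInner b P Q = 6 * (P ![b 0, b 1, b 2] * Q ![b 0, b 1, b 2]
      + P ![b 0, b 1, b 3] * Q ![b 0, b 1, b 3]
      + P ![b 0, b 2, b 3] * Q ![b 0, b 2, b 3]
      + P ![b 1, b 2, b 3] * Q ![b 1, b 2, b 3]) := by
  have p10 (α : W [⋀^Fin 3]→ₗ[ℝ] ℝ) (z) := (alternating_three_swap α (b 0) (b 1) z).1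
  have p20 (α : W [⋀^Fin 3]→ₗ[ℝ] ℝ) (z) := (alternating_three_swap α (b 0) (b 2) z).1
  have p30 (α : W [⋀^Fin 3]→ₗ[ℝ] ℝ) (z) := (alternating_three_swap α (b 0) (b 3) z).1
  have p21 (α : W [⋀^Fin 3]→ₗ[ℝ] ℝ) (z) := (alternating_three_swap α (b 1) (b 2) z).1
  have p31 (α : W [⋀^Fin 3]→ₗ[ℝ] ℝ) (z) := (alternating_three_swap α (b 1) (b 3) z).1
  have p32 (α : W [⋀^Fin 3]→ₗ[ℝ] ℝ) (z) := (alternating_three_swap α (b 2) (b 3) z).1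
  have q10 (α : W [⋀^Fin 3]→ₗ[ℝ] ℝ) (z) := (alternating_three_swap α z (b 0) (b 1)).2
  have q20 (α : W [⋀^Fin 3]→ₗ[ℝ] ℝ) (z) := (alternating_three_swap α z (b 0) (b 2)).2
  have q30 (α : W [⋀^Fin 3]→ₗ[ℝ] ℝ) (z) := (alternating_three_swap α z (b 0) (b 3)).2
  have q21 (α : W [⋀^Fin 3]→ₗ[ℝ] ℝ) (z) := (alternating_three_swap α z (b 1) (b 2)).2
  have q31 (α : W [⋀^Fin 3]→ₗ[ℝ] ℝ) (z) := (alternating_three_swap α z (b 1) (b 3)).2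
  have q32 (α : W [⋀^Fin 3]→ₗ[ℝ] ℝ) (z) := (alternating_three_swap α z (b 2) (b 3)).2
  simp only [tensorInner_three, Fin.sum_univ_four, alternating_three_self, p10, p20, p30, p21,
    p31, p32, q10, q20, q30, q21, q31, q32, neg_zero, mul_zero, neg_mul_neg, neg_neg]
  ring

/-- The components of `e_a ⌟ δ` for a 4-form `δ`. -/
theorem interiorProd_four_basis (δ : W [⋀^Fin 4]→ₗ[ℝ] ℝ) (a : Fin 4) :
    interiorProd (b a) δ ![b 0, b 1, b 2] = ![0, 0, 0, -δ ![b 0, b 1, b 2, b 3]] a ∧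
    interiorProd (b a) δ ![b 0, b 1, b 3] = ![0, 0, δ ![b 0, b 1, b 2, b 3], 0] a ∧
    interiorProd (b a) δ ![b 0, b 2, b 3] = ![0, -δ ![b 0, b 1, b 2, b 3], 0, 0] a ∧
    interiorProd (b a) δ ![b 1, b 2, b 3] = ![δ ![b 0, b 1, b 2, b 3], 0, 0, 0] a := by
  have p10 (z w) := (alternating_four_swap δ (b 0) (b 1) z w).1
  have p20 (z w) := (alternating_four_swap δ (b 0) (b 2) z w).1
  have p30 (z w) := (alternating_four_swap δ (b 0) (b 3) z w).1
  have p21 (z w) := (alternating_four_swap δ (b 1) (b 2) z w).1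
  have p31 (z w) := (alternating_four_swap δ (b 1) (b 3) z w).1
  have q21 (z w) := (alternating_four_swap δ z (b 1) (b 2) w).2.1
  have q31 (z w) := (alternating_four_swap δ z (b 1) (b 3) w).2.1
  have q32 (z w) := (alternating_four_swap δ z (b 2) (b 3) w).2.1
  have r32 (z w) := (alternating_four_swap δ z w (b 2) (b 3)).2.2
  fin_cases a <;>
    simp [interiorProd_four, alternating_four_self, p10, p20, p30, p21, p31, q21, q31, q32, r32]

theorem tensorInner_four (P Q : W [⋀^Fin 4]→ₗ[ℝ] ℝ) :
    tensorInner b P Q = 24 * (P ![b 0, b 1, b 2, b 3] * Q ![b 0, b 1, b 2, b 3]) := by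
  simp [tensorInner_succ b P, tensorInner_three_eq, Fin.sum_univ_four, interiorProd_four_basis]
  ring

theorem interiorProd_interiorProd (β : W [⋀^Fin 2]→ₗ[ℝ] ℝ) (v w : W) :
    interiorProd w (interiorProd v β) ![] = β ![v, w] := rfl

theorem interiorProd_eq_sum {k : ℕ} (α : W [⋀^Fin (k + 1)]→ₗ[ℝ] ℝ) (v : W) :
    interiorProd v α = ∑ a, (inner ℝ (b a) v : ℝ) • interiorProd (b a) α := by
  simp only [interiorProd, ← map_smul, ← map_sum, b.sum_repr']

section Action

variable {A : Type*} [Ring A] [Algebra ℂ A] {G : Fin 4 → A}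

/-- Repeated indices contribute nothing because the form alternates. For distinct indices a
transposition changes the sign of both the component and the product of generators, so the orderings
contribute equally and cancel the factorial. Degrees 3 and 4 work the same way. -/
theorem cliffordAction_two (hG : ∀ a c, a ≠ c → G a * G c = -(G c * G a))
    (β : W [⋀^Fin 2]→ₗ[ℝ] ℝ) :
    cliffordAction b G β = ((β ![b 0, b 1] : ℝ) : ℂ) • (G 0 * G 1)
      + ((β ![b 0, b 2] : ℝ) : ℂ) • (G 0 * G 2) + ((β ![b 0, b 3] : ℝ) : ℂ) • (G 0 * G 3)
      + ((β ![b 1, b 2] : ℝ) : ℂ) • (G 1 * G 2) + ((β ![b 1, b 3] : ℝ) : ℂ) • (G 1 * G 3)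
      + ((β ![b 2, b 3] : ℝ) : ℂ) • (G 2 * G 3) := by
  have g10 := hG 1 0 (by decide)
  have g20 := hG 2 0 (by decide)
  have g30 := hG 3 0 (by decide)
  have g21 := hG 2 1 (by decide)
  have g31 := hG 3 1 (by decide)
  have g32 := hG 3 2 (by decide)
  have p10 := alternating_two_swap β (b 0) (b 1)
  have p20 := alternating_two_swap β (b 0) (b 2)
  have p30 := alternating_two_swap β (b 0) (b 3)
  have p21 := alternating_two_swap β (b 1) (b 2)
  have p31 := alternating_two_swap β (b 1) (b 3)
  have p32 := alternating_two_swap β (b 2) (b 3)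
  simp only [cliffordAction_succ, cliffordAction_zero, Fin.sum_univ_four, mul_add, mul_smul_comm,
    mul_one, smul_add, interiorProd_interiorProd, alternating_two_self,
    p10, p20, p30, p21, p31, p32, g10, g20, g30, g21, g31, g32]
  push_cast
  module

theorem cliffordAction_three (hG : ∀ a c, a ≠ c → G a * G c = -(G c * G a))
    (τ : W [⋀^Fin 3]→ₗ[ℝ] ℝ) :
    cliffordAction b G τ = ((τ ![b 0, b 1, b 2] : ℝ) : ℂ) • (G 0 * (G 1 * G 2))
      + ((τ ![b 0, b 1, b 3] : ℝ) : ℂ) • (G 0 * (G 1 * G 3))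
      + ((τ ![b 0, b 2, b 3] : ℝ) : ℂ) • (G 0 * (G 2 * G 3))
      + ((τ ![b 1, b 2, b 3] : ℝ) : ℂ) • (G 1 * (G 2 * G 3)) := by
  have g10 := hG 1 0 (by decide)
  have g20 := hG 2 0 (by decide)
  have g30 := hG 3 0 (by decide)
  have g21 := hG 2 1 (by decide)
  have g31 := hG 3 1 (by decide)
  have g32 := hG 3 2 (by decide)
  have h10 (z : A) : G 1 * (G 0 * z) = -(G 0 * (G 1 * z)) := by
    rw [← mul_assoc, g10, neg_mul, mul_assoc]
  have h20 (z : A) : G 2 * (G 0 * z) = -(G 0 * (G 2 * z)) := by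
    rw [← mul_assoc, g20, neg_mul, mul_assoc]
  have h30 (z : A) : G 3 * (G 0 * z) = -(G 0 * (G 3 * z)) := by
    rw [← mul_assoc, g30, neg_mul, mul_assoc]
  have h21 (z : A) : G 2 * (G 1 * z) = -(G 1 * (G 2 * z)) := by
    rw [← mul_assoc, g21, neg_mul, mul_assoc]
  have h31 (z : A) : G 3 * (G 1 * z) = -(G 1 * (G 3 * z)) := by
    rw [← mul_assoc, g31, neg_mul, mul_assoc]
  have h32 (z : A) : G 3 * (G 2 * z) = -(G 2 * (G 3 * z)) := by
    rw [← mul_assoc, g32, neg_mul, mul_assoc]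
  have p10 (z) := (alternating_three_swap τ (b 0) (b 1) z).1
  have p20 (z) := (alternating_three_swap τ (b 0) (b 2) z).1
  have p30 (z) := (alternating_three_swap τ (b 0) (b 3) z).1
  have p21 (z) := (alternating_three_swap τ (b 1) (b 2) z).1
  have p31 (z) := (alternating_three_swap τ (b 1) (b 3) z).1
  have p32 (z) := (alternating_three_swap τ (b 2) (b 3) z).1
  have q21 (z) := (alternating_three_swap τ z (b 1) (b 2)).2
  have q31 (z) := (alternating_three_swap τ z (b 1) (b 3)).2
  have q32 (z) := (alternating_three_swap τ z (b 2) (b 3)).2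
  simp only [cliffordAction_succ b G τ, cliffordAction_two b hG, interiorProd_three,
    Fin.sum_univ_four, mul_add, mul_smul_comm, smul_add, alternating_three_self, mul_neg, neg_neg,
    p10, p20, p30, p21, p31, p32, q21, q31, q32, g21, g31, g32,
    h10, h20, h30, h21, h31, h32]
  push_cast
  module

theorem cliffordAction_four (hG : ∀ a c, a ≠ c → G a * G c = -(G c * G a))
    (δ : W [⋀^Fin 4]→ₗ[ℝ] ℝ) :
    cliffordAction b G δ =
      ((δ ![b 0, b 1, b 2, b 3] : ℝ) : ℂ) • (G 0 * (G 1 * (G 2 * G 3))) := by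
  have g10 := hG 1 0 (by decide)
  have g20 := hG 2 0 (by decide)
  have g30 := hG 3 0 (by decide)
  have g21 := hG 2 1 (by decide)
  have g31 := hG 3 1 (by decide)
  have g32 := hG 3 2 (by decide)
  have h10 (z : A) : G 1 * (G 0 * z) = -(G 0 * (G 1 * z)) := by
    rw [← mul_assoc, g10, neg_mul, mul_assoc]
  have h20 (z : A) : G 2 * (G 0 * z) = -(G 0 * (G 2 * z)) := by
    rw [← mul_assoc, g20, neg_mul, mul_assoc]
  have h30 (z : A) : G 3 * (G 0 * z) = -(G 0 * (G 3 * z)) := by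
    rw [← mul_assoc, g30, neg_mul, mul_assoc]
  have h21 (z : A) : G 2 * (G 1 * z) = -(G 1 * (G 2 * z)) := by
    rw [← mul_assoc, g21, neg_mul, mul_assoc]
  have h31 (z : A) : G 3 * (G 1 * z) = -(G 1 * (G 3 * z)) := by
    rw [← mul_assoc, g31, neg_mul, mul_assoc]
  have h32 (z : A) : G 3 * (G 2 * z) = -(G 2 * (G 3 * z)) := by
    rw [← mul_assoc, g32, neg_mul, mul_assoc]
  simp only [cliffordAction_succ b G δ, cliffordAction_three b hG, interiorProd_four_basis,
    Fin.sum_univ_four, mul_add, mul_smul_comm, smul_add, mul_neg, neg_neg, Matrix.cons_val,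
    g32, h10, h20, h30, h21, h31, h32]
  push_cast
  module

/-- `T · v + v ⌟ T` acts as a multiple of the volume element. -/
theorem cliffordAction_three_mul_vector (hG : ∀ a c, a ≠ c → G a * G c = -(G c * G a))
    (hG2 : ∀ a, G a * G a = -1) (τ : W [⋀^Fin 3]→ₗ[ℝ] ℝ) (v : W) :
    cliffordAction b G τ * (∑ a, ((inner ℝ (b a) v : ℝ) : ℂ) • G a)
        + cliffordAction b G (interiorProd v τ) =
      ((τ ![b 0, b 1, b 2] * inner ℝ (b 3) v - τ ![b 0, b 1, b 3] * inner ℝ (b 2) v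
        + τ ![b 0, b 2, b 3] * inner ℝ (b 1) v - τ ![b 1, b 2, b 3] * inner ℝ (b 0) v : ℝ) : ℂ) •
        (G 0 * (G 1 * (G 2 * G 3))) := by
  have g10 := hG 1 0 (by decide)
  have g20 := hG 2 0 (by decide)
  have g30 := hG 3 0 (by decide)
  have g21 := hG 2 1 (by decide)
  have g31 := hG 3 1 (by decide)
  have g32 := hG 3 2 (by decide)
  have h10 (z : A) : G 1 * (G 0 * z) = -(G 0 * (G 1 * z)) := by
    rw [← mul_assoc, g10, neg_mul, mul_assoc]
  have h20 (z : A) : G 2 * (G 0 * z) = -(G 0 * (G 2 * z)) := by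
    rw [← mul_assoc, g20, neg_mul, mul_assoc]
  have h21 (z : A) : G 2 * (G 1 * z) = -(G 1 * (G 2 * z)) := by
    rw [← mul_assoc, g21, neg_mul, mul_assoc]
  have p10 (z) := (alternating_three_swap τ (b 0) (b 1) z).1
  have p20 (z) := (alternating_three_swap τ (b 0) (b 2) z).1
  have p30 (z) := (alternating_three_swap τ (b 0) (b 3) z).1
  have p21 (z) := (alternating_three_swap τ (b 1) (b 2) z).1
  have p31 (z) := (alternating_three_swap τ (b 1) (b 3) z).1
  have p32 (z) := (alternating_three_swap τ (b 2) (b 3) z).1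
  have q21 (z) := (alternating_three_swap τ z (b 1) (b 2)).2
  have q31 (z) := (alternating_three_swap τ z (b 1) (b 3)).2
  have q32 (z) := (alternating_three_swap τ z (b 2) (b 3)).2
  have s (a) (z : A) : G a * (G a * z) = -z := by rw [← mul_assoc, hG2, neg_one_mul]
  have hv (x y : W) : τ ![v, x, y] = ∑ a, inner ℝ (b a) v * τ ![b a, x, y] := by
    rw [← interiorProd_three, interiorProd_eq_sum b, Fin.sum_univ_four, Fin.sum_univ_four]
    rfl
  -- A product e_i e_j e_k e_l with distinct indices is ± the volume element; if l is one of i, j,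
  -- k, a product of two generators remains, and these terms sum to the action of -(v ⌟ τ).
  simp only [cliffordAction_three b hG, cliffordAction_two b hG, interiorProd_three, hv,
    Fin.sum_univ_four, mul_add, add_mul, mul_smul_comm, smul_mul_assoc, smul_add, mul_neg, neg_neg,
    mul_assoc, hG2, s, mul_one, alternating_three_self,
    p10, p20, p30, p21, p31, p32, q21, q31, q32, g20, g30, g21, g31, g32,
    h10, h20, h21]
  push_cast
  module

end Action

end FormComponents

/-! ### Scalar products of forms in terms of the coefficient of τ ∧ v^♭. -/

section PotentialAlgebra

variable {W : Type*} [NormedAddCommGroup W] [InnerProductSpace ℝ W]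
  (b : OrthonormalBasis (Fin 4) ℝ W)

/-- The component `(τ ∧ v^♭)(e₀, e₁, e₂, e₃)` of the wedge product of a 3-form and a 1-form. -/
def wedgeFlat (τ : W [⋀^Fin 3]→ₗ[ℝ] ℝ) (v : W) : ℝ :=
  τ ![b 0, b 1, b 2] * inner ℝ (b 3) v - τ ![b 0, b 1, b 3] * inner ℝ (b 2) v
    + τ ![b 0, b 2, b 3] * inner ℝ (b 1) v - τ ![b 1, b 2, b 3] * inner ℝ (b 0) v

theorem interiorProd_apply_eq_sum {k : ℕ} (α : W [⋀^Fin (k + 1)]→ₗ[ℝ] ℝ) (v : W)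
    (m : Fin k → W) :
    interiorProd v α m = ∑ a, inner ℝ (b a) v * interiorProd (b a) α m := by
  rw [interiorProd_eq_sum b, Fin.sum_univ_four, Fin.sum_univ_four]
  rfl

theorem inner_self_eq_sum (v : W) : inner ℝ v v = ∑ a, inner ℝ (b a) v * inner ℝ (b a) v := by
  rw [← b.sum_inner_mul_inner v v]
  simp only [real_inner_comm]

theorem volForm_basis : volForm b ![b 0, b 1, b 2, b 3] = 1 := by
  have : ![b 0, b 1, b 2, b 3] = b.toBasis := by
    ext i; fin_cases i <;> simp
  rw [volForm, this, Module.Basis.det_self]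

/-- The factor 6 = 3! passes from the norm of forms to that of tensors. The sign comes from ∗∗ = -1
on 1-forms in dimension 4: ⟨τ, ∗v⟩ ω = τ ∧ ∗∗v = -τ ∧ v for the scalar product of forms. -/
theorem tensorInner_hodgeOneForm_flat (τ : W [⋀^Fin 3]→ₗ[ℝ] ℝ) (v : W) :
    tensorInner b τ (hodgeOneForm b (flat v)) = -(6 * wedgeFlat b τ v) := by
  have h (m : Fin 3 → W) : hodgeOneForm b (flat v) m =
      ∑ a, inner ℝ (b a) v * interiorProd (b a) (volForm b) m := by
    rw [hodgeOneForm, Fin.sum_univ_four, Fin.sum_univ_four]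
    simp only [flat, innerₗ_apply_apply, real_inner_comm v]
    rfl
  simp [tensorInner_three_eq, h, interiorProd_four_basis, Fin.sum_univ_four, volForm_basis,
    wedgeFlat]
  ring

/-- As δ is a multiple of the volume form, v ⌟ δ is the same multiple of ∗v^♭; hence the same sign
and factor as for the Hodge star. -/
theorem tensorInner_interiorProd_four (δ : W [⋀^Fin 4]→ₗ[ℝ] ℝ) (τ : W [⋀^Fin 3]→ₗ[ℝ] ℝ) (v : W) :
    tensorInner b (interiorProd v δ) τ =
      -(6 * (δ ![b 0, b 1, b 2, b 3] * wedgeFlat b τ v)) := by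
  simp [tensorInner_three_eq, interiorProd_apply_eq_sum b δ v, interiorProd_four_basis,
    Fin.sum_univ_four, wedgeFlat]
  ring

theorem tensorInner_two_eq (P Q : W [⋀^Fin 2]→ₗ[ℝ] ℝ) :
    tensorInner b P Q = 2 * (P ![b 0, b 1] * Q ![b 0, b 1] + P ![b 0, b 2] * Q ![b 0, b 2]
      + P ![b 0, b 3] * Q ![b 0, b 3] + P ![b 1, b 2] * Q ![b 1, b 2]
      + P ![b 1, b 3] * Q ![b 1, b 3] + P ![b 2, b 3] * Q ![b 2, b 3]) := by
  have p10 (α : W [⋀^Fin 2]→ₗ[ℝ] ℝ) := alternating_two_swap α (b 0) (b 1)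
  have p20 (α : W [⋀^Fin 2]→ₗ[ℝ] ℝ) := alternating_two_swap α (b 0) (b 2)
  have p30 (α : W [⋀^Fin 2]→ₗ[ℝ] ℝ) := alternating_two_swap α (b 0) (b 3)
  have p21 (α : W [⋀^Fin 2]→ₗ[ℝ] ℝ) := alternating_two_swap α (b 1) (b 2)
  have p31 (α : W [⋀^Fin 2]→ₗ[ℝ] ℝ) := alternating_two_swap α (b 1) (b 3)
  have p32 (α : W [⋀^Fin 2]→ₗ[ℝ] ℝ) := alternating_two_swap α (b 2) (b 3)
  simp only [tensorInner_two, Fin.sum_univ_four, alternating_two_self, p10, p20, p30, p21, p31,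
    p32, neg_mul_neg, mul_zero]
  ring

/-- `‖v ⌟ τ‖² = |v|² ‖τ‖² / 3 - 2 |τ ∧ v|²`. -/
theorem tensorInner_interiorProd_three_self (τ : W [⋀^Fin 3]→ₗ[ℝ] ℝ) (v : W) :
    tensorInner b (interiorProd v τ) (interiorProd v τ) =
      inner ℝ v v * tensorInner b τ τ / 3 - 2 * wedgeFlat b τ v ^ 2 := by
  have p10 (z) := (alternating_three_swap τ (b 0) (b 1) z).1
  have p20 (z) := (alternating_three_swap τ (b 0) (b 2) z).1
  have p30 (z) := (alternating_three_swap τ (b 0) (b 3) z).1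
  have p21 (z) := (alternating_three_swap τ (b 1) (b 2) z).1
  have p31 (z) := (alternating_three_swap τ (b 1) (b 3) z).1
  have p32 (z) := (alternating_three_swap τ (b 2) (b 3) z).1
  have q21 (z) := (alternating_three_swap τ z (b 1) (b 2)).2
  have q31 (z) := (alternating_three_swap τ z (b 1) (b 3)).2
  have q32 (z) := (alternating_three_swap τ z (b 2) (b 3)).2
  simp only [tensorInner_two_eq, tensorInner_three_eq, interiorProd_apply_eq_sum b τ v,
    interiorProd_three, Fin.sum_univ_four, wedgeFlat, inner_self_eq_sum b v,
    alternating_three_self, p10, p20, p30, p21, p31, p32, q21, q31, q32]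
  ring

end PotentialAlgebra

/-! ### The potential as f · 1 + c · ω on spinors, and its traces. -/

section SpinorTraces

theorem gammaLin_single (a : Fin 4) : gammaLin (Pi.single a 1) = gammaMat a := by
  simp [gammaLin, Finset.sum_apply, Pi.single_apply]

/-- Polarisation of `gammaLin_sq` at a sum of two basis vectors. -/
theorem gammaMat_anticommutator (a c : Fin 4) :
    gammaMat a * gammaMat c + gammaMat c * gammaMat a = if a = c then -2 else 0 := by
  have h := gammaLin_sq (Pi.single a 1 + Pi.single c 1)
  have ha := gammaLin_sq (Pi.single a 1)
  have hc := gammaLin_sq (Pi.single c 1)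
  rw [map_add, gammaLin_single, gammaLin_single] at h
  rw [gammaLin_single] at ha hc
  have hexp : gammaMat a * gammaMat c + gammaMat c * gammaMat a =
      (gammaMat a + gammaMat c) * (gammaMat a + gammaMat c) - gammaMat a * gammaMat a
        - gammaMat c * gammaMat c := by noncomm_ring
  rw [hexp, h, ha, hc, ← map_sub, ← map_sub]
  have hq : negQ (Pi.single a 1 + Pi.single c 1) - negQ (Pi.single a 1) - negQ (Pi.single c 1) =
      if a = c then -2 else 0 := by
    fin_cases a <;> fin_cases c <;>
      simp [negQ, QuadraticMap.weightedSumSquares_apply, Fin.sum_univ_four, Pi.single_apply] <;>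
      norm_num
  rw [hq]
  split_ifs
  · rw [map_neg, map_ofNat]
  · rw [map_zero]

theorem gammaMat_mul_self (a : Fin 4) : gammaMat a * gammaMat a = -1 := by
  have h := gammaMat_anticommutator a a
  rw [if_pos rfl, ← two_smul ℂ] at h
  have h2 := congrArg (fun A => (1 / 2 : ℂ) • A) h
  simp only [smul_smul] at h2
  have h3 : (-2 : Matrix (Fin 4) (Fin 4) ℂ) = (2 : ℂ) • (-1) := by
    rw [smul_neg, two_smul, one_add_one_eq_two]
  rw [h3, smul_smul] at h2
  norm_num at h2
  exact h2

theorem gammaMat_anticomm (a c : Fin 4) (h : a ≠ c) :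
    gammaMat a * gammaMat c = -(gammaMat c * gammaMat a) := by
  have h' := gammaMat_anticommutator a c
  rw [if_neg h] at h'
  exact eq_neg_of_add_eq_zero_left h'

/-- The eigenspaces of the volume element for 1 and -1, the two half-spinor spaces, have equal
dimension. -/
theorem trace_gammaMat_volume :
    (gammaMat 0 * (gammaMat 1 * (gammaMat 2 * gammaMat 3))).trace = 0 := by
  simp [gammaMat, Matrix.trace, Fin.sum_univ_four]

variable {M : Type*} [TopologicalSpace M] [ChartedSpace E4 M] [IsManifold (𝓡 4) ∞ M]
  [RiemannianBundle (fun x : M => TangentSpace (𝓡 4) x)] {ι : Type*} (S : SpinStructure M ι)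

namespace SpinStructure

/-- The endomorphism of the spinor space at `x` given by a matrix, in the trivialization of
`S.frameBasis x`. -/
def matrixAction (x : M) : Matrix (Fin 4) (Fin 4) ℂ →ₐ[ℂ] Module.End ℂ (S.Spinors x) :=
  (Matrix.toLpLinAlgEquiv (n := Fin 4) (R := ℂ) 2).toAlgHom

theorem trace_matrixAction (x : M) (A : Matrix (Fin 4) (Fin 4) ℂ) :
    LinearMap.trace ℂ (S.Spinors x) (S.matrixAction x A) = A.trace := by
  have h : LinearMap.trace ℂ Spinor4 (Matrix.toLpLin 2 2 A) = A.trace := by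
    rw [Matrix.toLpLin_eq_toLin, Matrix.trace_toLin_eq]
  exact h

theorem cliffordVec_eq (x : M) (v : TangentSpace (𝓡 4) x) :
    S.cliffordVec v = S.matrixAction x (gammaLin fun a => inner ℝ (S.frameBasis x a) v) := rfl

theorem cliffordVec_frameBasis (x : M) (a : Fin 4) :
    S.cliffordVec (S.frameBasis x a) = S.matrixAction x (gammaMat a) := by
  have : (fun c => inner ℝ (S.frameBasis x c) (S.frameBasis x a)) = Pi.single a (1 : ℝ) := by
    funext c
    rw [OrthonormalBasis.inner_eq_ite, Pi.single_apply]
  rw [cliffordVec_eq, this, gammaLin_single]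

theorem cliffordVec_eq_sum {x : M} (v : TangentSpace (𝓡 4) x) :
    S.cliffordVec v = ∑ a, ((inner ℝ (S.frameBasis x a) v : ℝ) : ℂ) •
      S.cliffordVec (S.frameBasis x a) := by
  simp only [cliffordVec_frameBasis]
  rw [cliffordVec_eq]
  simp only [← map_smul, ← map_sum]
  congr 1

theorem cliffordForm_eq {x : M} {k : ℕ} (α : TangentSpace (𝓡 4) x [⋀^Fin k]→ₗ[ℝ] ℝ) :
    S.cliffordForm α =
      cliffordAction (S.frameBasis x) (fun a => S.cliffordVec (S.frameBasis x a)) α := rfl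

/-- The volume element `e₀ · e₁ · e₂ · e₃`. -/
def volumeElement (x : M) : Module.End ℂ (S.Spinors x) :=
  S.cliffordVec (S.frameBasis x 0) * (S.cliffordVec (S.frameBasis x 1) *
    (S.cliffordVec (S.frameBasis x 2) * S.cliffordVec (S.frameBasis x 3)))

theorem cliffordVec_anticomm (x : M) (a c : Fin 4) (h : a ≠ c) :
    S.cliffordVec (S.frameBasis x a) * S.cliffordVec (S.frameBasis x c) =
      -(S.cliffordVec (S.frameBasis x c) * S.cliffordVec (S.frameBasis x a)) := by
  simp only [cliffordVec_frameBasis, ← map_mul, ← map_neg, gammaMat_anticomm a c h]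

theorem cliffordVec_mul_self (x : M) (a : Fin 4) :
    S.cliffordVec (S.frameBasis x a) * S.cliffordVec (S.frameBasis x a) = -1 := by
  simp only [cliffordVec_frameBasis, ← map_mul, gammaMat_mul_self, map_neg, map_one]

theorem volumeElement_mul_self (x : M) : S.volumeElement x * S.volumeElement x = 1 :=
  volume_element_sq (S.cliffordVec_anticomm x) (S.cliffordVec_mul_self x)

theorem trace_volumeElement (x : M) :
    LinearMap.trace ℂ (S.Spinors x) (S.volumeElement x) = 0 := by
  simp only [volumeElement, cliffordVec_frameBasis, ← map_mul, trace_matrixAction,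
    trace_gammaMat_volume]

theorem trace_one_spinors (x : M) : LinearMap.trace ℂ (S.Spinors x) 1 = 4 := by
  rw [← map_one (S.matrixAction x), trace_matrixAction]
  simp

theorem cliffordForm_four {x : M} (δ : TangentSpace (𝓡 4) x [⋀^Fin 4]→ₗ[ℝ] ℝ) :
    S.cliffordForm δ = ((δ ![S.frameBasis x 0, S.frameBasis x 1, S.frameBasis x 2,
      S.frameBasis x 3] : ℝ) : ℂ) • S.volumeElement x := by
  rw [cliffordForm_eq, cliffordAction_four _ (S.cliffordVec_anticomm x)]
  rfl

theorem cliffordForm_vol (x : M) : S.cliffordForm (S.vol x) = S.volumeElement x := by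
  rw [cliffordForm_four, vol, volForm_basis]
  simp

theorem cliffordForm_three_mul_cliffordVec {x : M} (τ : TangentSpace (𝓡 4) x [⋀^Fin 3]→ₗ[ℝ] ℝ)
    (v : TangentSpace (𝓡 4) x) :
    S.cliffordForm τ * S.cliffordVec v + S.cliffordForm (interiorProd v τ) =
      ((wedgeFlat (S.frameBasis x) τ v : ℝ) : ℂ) • S.volumeElement x := by
  rw [cliffordVec_eq_sum, cliffordForm_eq, cliffordForm_eq,
    cliffordAction_three_mul_vector _ (S.cliffordVec_anticomm x) (S.cliffordVec_mul_self x)]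
  rfl

variable (D : TangentConnection M) (V : (x : M) → TangentSpace (𝓡 4) x)
  (T : (x : M) → TangentSpace (𝓡 4) x [⋀^Fin 3]→L[ℝ] ℝ)

/-- The coefficient of the identity in the potential. -/
def potentialScalar (x : M) : ℝ :=
  -(1 / 4) * scalarCurvature D x (S.frameBasis x)
    + 3 / 4 * tensorInner (S.frameBasis x) (T x).toAlternatingMap (T x).toAlternatingMap
    - 3 / 2 * divergence D V x (S.frameBasis x) + 9 / 2 * inner ℝ (V x) (V x)

/-- The coefficient of the volume element in the potential. -/
def potentialPseudoscalar (x : M) : ℝ :=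
  -(3 / 2) * exteriorDerivative T x ![S.frameBasis x 0, S.frameBasis x 1, S.frameBasis x 2,
      S.frameBasis x 3]
    - 9 * wedgeFlat (S.frameBasis x) (T x).toAlternatingMap (V x)

/-- The terms 9 T · V and 9 (V ⌟ T) carry the same factor, which is exactly what makes their 2-form
parts cancel; dT contributes only to the volume element because it has top degree. -/
theorem potential_eq (x : M) :
    S.potential D V T x = ((S.potentialScalar D V T x : ℝ) : ℂ) • (1 : Module.End ℂ (S.Spinors x))
      + ((S.potentialPseudoscalar V T x : ℝ) : ℂ) • S.volumeElement x := by
  have h := S.cliffordForm_three_mul_cliffordVec (T x).toAlternatingMap (V x)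
  rw [← eq_sub_iff_add_eq] at h
  simp only [potential, h, cliffordForm_four]
  rw [potentialPseudoscalar, potentialScalar]
  push_cast
  simp only [ContinuousAlternatingMap.coe_toAlternatingMap]
  module

theorem trace_scalar_add_volume (x : M) (f c : ℂ) :
    LinearMap.trace ℂ (S.Spinors x) (f • (1 : Module.End ℂ (S.Spinors x)) + c • S.volumeElement x)
      = 4 * f := by
  rw [map_add, map_smul, map_smul, trace_one_spinors, trace_volumeElement]
  simp [mul_comm]

/-- The traces in terms of the two coefficients of the potential. -/
theorem trace_potential (x : M) :
    let E := S.potential D V T x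
    let f := S.potentialScalar D V T x
    let c := S.potentialPseudoscalar V T x
    LinearMap.trace ℂ (S.Spinors x) E = ((4 * f : ℝ) : ℂ) ∧
    LinearMap.trace ℂ (S.Spinors x) (E ^ 2) = ((4 * (f ^ 2 + c ^ 2) : ℝ) : ℂ) ∧
    LinearMap.trace ℂ (S.Spinors x) (E * S.cliffordForm (S.vol x)) = ((4 * c : ℝ) : ℂ) ∧
    LinearMap.trace ℂ (S.Spinors x) (E ^ 2 * S.cliffordForm (S.vol x)) =
      ((8 * (f * c) : ℝ) : ℂ) := by
  intro E f c
  have hE : E = (f : ℂ) • (1 : Module.End ℂ (S.Spinors x)) + (c : ℂ) • S.volumeElement x :=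
    S.potential_eq D V T x
  have hω := S.volumeElement_mul_self x
  have hE2 : E ^ 2 = ((f : ℂ) ^ 2 + (c : ℂ) ^ 2) • (1 : Module.End ℂ (S.Spinors x))
      + (2 * (f : ℂ) * c) • S.volumeElement x := by
    rw [hE, pow_two]
    simp only [add_mul, mul_add, smul_mul_smul_comm, hω, one_mul, mul_one]
    module
  -- As ω² = 1, multiplication by ω interchanges the two coefficients, which reduces the last two
  -- traces to the first kind.
  have hmul (p q : ℂ) : (p • (1 : Module.End ℂ (S.Spinors x)) + q • S.volumeElement x)
      * S.volumeElement x = q • (1 : Module.End ℂ (S.Spinors x)) + p • S.volumeElement x := by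
    simp only [add_mul, smul_mul_assoc, hω, one_mul]
    rw [add_comm]
  rw [cliffordForm_vol, hE2, hE, hmul, hmul]
  simp only [trace_scalar_add_volume]
  push_cast
  exact ⟨rfl, rfl, rfl, by ring⟩

end SpinStructure

end SpinorTraces

/-! ### Pointwise algebra of the difference tensor A(Y)X = `torsionTensor v τ Y X`. -/

section TorsionAlgebra

variable {W : Type*} [NormedAddCommGroup W] [InnerProductSpace ℝ W]

theorem alternating_three_swap_continuous (τ : W [⋀^Fin 3]→L[ℝ] ℝ) (x y z : W) :
    τ ![y, x, z] = -τ ![x, y, z] ∧ τ ![x, z, y] = -τ ![x, y, z] :=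
  alternating_three_swap τ.toAlternatingMap x y z

theorem alternating_three_self_continuous (τ : W [⋀^Fin 3]→L[ℝ] ℝ) (x y : W) :
    τ ![x, x, y] = 0 ∧ τ ![y, x, x] = 0 ∧ τ ![x, y, x] = 0 := by
  have h := alternating_three_self τ.toAlternatingMap x y
  refine ⟨h.1, h.2, ?_⟩
  rw [(alternating_three_swap_continuous τ x x y).2]
  exact neg_eq_zero.2 h.1

variable [FiniteDimensional ℝ W]

theorem torsionTensor_apply (v : W) (τ : W [⋀^Fin 3]→L[ℝ] ℝ) (X Y : W) :
    torsionTensor v τ Y X = (inner ℝ X Y : ℝ) • v - (inner ℝ v Y : ℝ) • X + sharp (fillTwo τ X Y) :=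
  rfl

theorem inner_torsionTensor (v : W) (τ : W [⋀^Fin 3]→L[ℝ] ℝ) (X Y Z : W) :
    inner ℝ (torsionTensor v τ Y X) Z =
      inner ℝ X Y * inner ℝ v Z - inner ℝ v Y * inner ℝ X Z + τ ![X, Y, Z] := by
  simp [torsionTensor_apply, inner_add_left, inner_sub_left, inner_smul_left, inner_sharp,
    fillTwo_apply]

/-- τ disappears altogether: A(Y)Y = |Y|² v - ⟨v, Y⟩ Y since τ(Y, Y, ·) = 0, and the outer
contribution is τ(X, ·, X) = 0. -/
theorem inner_torsionTensor_torsionTensor_self (v : W) (τ : W [⋀^Fin 3]→L[ℝ] ℝ) (X Y : W) :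
    inner ℝ (torsionTensor v τ (torsionTensor v τ Y Y) X) X =
      (inner ℝ Y Y * inner ℝ v X - inner ℝ v Y * inner ℝ X Y) * inner ℝ v X
        - (inner ℝ Y Y * inner ℝ v v - inner ℝ v Y * inner ℝ v Y) * inner ℝ X X := by
  have h1 := inner_torsionTensor v τ Y Y X
  have h2 := inner_torsionTensor v τ Y Y v
  rw [(alternating_three_self_continuous τ Y _).1, real_inner_comm] at h1 h2
  rw [inner_torsionTensor, (alternating_three_self_continuous τ X _).2.2, h1, h2,
    real_inner_comm Y v, real_inner_comm X Y]
  ring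

/-- Cyclic symmetry gives τ(Y, Z, X) = ⟨τ(X, Y, ·)^♯, Z⟩. Taking Z = A(Y)X produces the square of
τ(X, Y, ·)^♯, while the two mixed terms ± ⟨X, Y⟩ τ(X, Y, v) cancel. -/
theorem inner_torsionTensor_torsionTensor_swap (v : W) (τ : W [⋀^Fin 3]→L[ℝ] ℝ) (X Y : W) :
    inner ℝ (torsionTensor v τ (torsionTensor v τ Y X) Y) X =
      inner ℝ v Y * inner ℝ v X * inner ℝ X Y - inner ℝ X Y * inner ℝ X Y * inner ℝ v v
        + inner ℝ (sharp (fillTwo τ X Y)) (sharp (fillTwo τ X Y)) := by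
  have hs (Z : W) : τ ![Y, Z, X] = inner ℝ (sharp (fillTwo τ X Y)) Z := by
    rw [inner_sharp, fillTwo_apply, (alternating_three_swap_continuous τ Y X Z).2,
      (alternating_three_swap_continuous τ X Y Z).1, neg_neg]
  have h1 := inner_torsionTensor v τ X Y Y
  have h2 := inner_torsionTensor v τ X Y v
  have h3 := inner_torsionTensor v τ X Y (sharp (fillTwo τ X Y))
  have h4 : inner ℝ v (sharp (fillTwo τ X Y)) = τ ![X, Y, v] := by
    rw [real_inner_comm, inner_sharp, fillTwo_apply]
  have h5 : inner ℝ X (sharp (fillTwo τ X Y)) = 0 := by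
    rw [real_inner_comm, inner_sharp, fillTwo_apply, (alternating_three_self_continuous τ X _).2.2]
  have h6 : τ ![X, Y, sharp (fillTwo τ X Y)] =
      inner ℝ (sharp (fillTwo τ X Y)) (sharp (fillTwo τ X Y)) := by
    rw [inner_sharp (fillTwo τ X Y), fillTwo_apply]
  rw [real_inner_comm] at h1 h2 h3
  rw [(alternating_three_self_continuous τ Y X).2.1, add_zero] at h1
  rw [h4, h5, h6] at h3
  rw [inner_torsionTensor, hs, h1, h2, h3, real_inner_comm X Y, real_inner_comm X v]
  ring

theorem sum_inner_sharp_fillTwo_self (b : OrthonormalBasis (Fin 4) ℝ W)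
    (τ : W [⋀^Fin 3]→L[ℝ] ℝ) :
    ∑ i, ∑ j, inner ℝ (sharp (fillTwo τ (b i) (b j))) (sharp (fillTwo τ (b i) (b j))) =
      tensorInner b τ.toAlternatingMap τ.toAlternatingMap := by
  rw [tensorInner_three]
  refine Finset.sum_congr rfl fun i _ => Finset.sum_congr rfl fun j _ => ?_
  rw [inner_self_eq_sum b]
  refine Finset.sum_congr rfl fun k _ => ?_
  rw [real_inner_comm, inner_sharp, fillTwo_apply]
  rfl

/-- The difference of the scalar curvatures of the connections `D + A` and `D`, in terms of the
values of `A = torsionTensor v τ` and of `N = D V` at a point. -/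
theorem sum_curvature_difference (b : OrthonormalBasis (Fin 4) ℝ W) (v : W)
    (τ : W [⋀^Fin 3]→L[ℝ] ℝ) (N : W → W) :
    ∑ i, ∑ j, (inner ℝ (b j) (b j) * inner ℝ (N (b i)) (b i)
        - inner ℝ (N (b i)) (b j) * inner ℝ (b i) (b j)
        - inner ℝ (b i) (b j) * inner ℝ (N (b j)) (b i)
        + inner ℝ (N (b j)) (b j) * inner ℝ (b i) (b i)
        + inner ℝ (torsionTensor v τ (torsionTensor v τ (b j) (b j)) (b i)) (b i)
        - inner ℝ (torsionTensor v τ (torsionTensor v τ (b j) (b i)) (b j)) (b i)) =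
      6 * ∑ i, inner ℝ (N (b i)) (b i) - 6 * inner ℝ v v
        - tensorInner b τ.toAlternatingMap τ.toAlternatingMap := by
  -- In dimension n the two coefficients are 2(n - 1) for the divergence and (n - 1)(n - 2) for
  -- |v|²; both equal 6 when n = 4.
  rw [← sum_inner_sharp_fillTwo_self]
  simp only [inner_torsionTensor_torsionTensor_self, inner_torsionTensor_torsionTensor_swap,
    b.inner_eq_ite, sub_add_eq_sub_sub, Finset.sum_sub_distrib _ _]
  rw [inner_self_eq_sum b v]
  simp [Fin.sum_univ_four, real_inner_comm v]
  ring

end TorsionAlgebra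

/-- The algebraic identity behind the comparison of curvatures: `dXu` stands for `D_u X`, etc.,
`p` and `q` for `D_u (A(Y)Y)` and `D_w (A(Y)X)`, where `u` and `w` are the values of `X`
and `Y`. -/
theorem curvature_difference_algebra {W : Type*} [NormedAddCommGroup W] [InnerProductSpace ℝ W]
    [FiniteDimensional ℝ W] (v : W) (τ : W [⋀^Fin 3]→L[ℝ] ℝ)
    (u w dXu dXw dYu dYw dVu dVw p q r s t : W)
    (e1 : (inner ℝ dYu w + inner ℝ w dYu) * inner ℝ v u
      + inner ℝ w w * (inner ℝ dVu u + inner ℝ v dXu)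
      - (inner ℝ dVu w + inner ℝ v dYu) * inner ℝ w u
      - inner ℝ v w * (inner ℝ dYu u + inner ℝ w dXu) =
      inner ℝ p u + inner ℝ (torsionTensor v τ w w) dXu)
    (e2 : (inner ℝ dXw w + inner ℝ u dYw) * inner ℝ v u
      + inner ℝ u w * (inner ℝ dVw u + inner ℝ v dXw)
      - (inner ℝ dVw w + inner ℝ v dYw) * inner ℝ u u
      - inner ℝ v w * (inner ℝ dXw u + inner ℝ u dXw) =
      inner ℝ q u + inner ℝ (torsionTensor v τ w u) dXw) :
    inner ℝ ((r + p + torsionTensor v τ dYw u + torsionTensor v τ (torsionTensor v τ w w) u)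
        - (s + q + torsionTensor v τ dYu w + torsionTensor v τ (torsionTensor v τ w u) w)
        - (t + torsionTensor v τ w (dYu - dXw))) u =
      inner ℝ (r - s - t) u +
      (inner ℝ w w * inner ℝ dVu u - inner ℝ dVu w * inner ℝ u w
        - inner ℝ u w * inner ℝ dVw u + inner ℝ dVw w * inner ℝ u u
        + inner ℝ (torsionTensor v τ (torsionTensor v τ w w) u) u
        - inner ℝ (torsionTensor v τ (torsionTensor v τ w u) w) u) := by
  have h1 := inner_torsionTensor v τ w w dXu
  have h2 := inner_torsionTensor v τ u w dXw
  have h3 := inner_torsionTensor v τ u dYw u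
  have h4 := inner_torsionTensor v τ w dYu u
  have h5 := inner_torsionTensor v τ dYu w u
  have h6 := inner_torsionTensor v τ dXw w u
  rw [(alternating_three_self_continuous τ w _).1] at h1
  rw [(alternating_three_self_continuous τ u _).2.2] at h3
  -- Bringing the values of τ to a common order makes those involving derivatives of X and Y cancel
  -- in pairs: the two with `dYu` inside the goal, and the one with `dXw` against its counterpart in
  -- `e2`. Then `e1` and `e2` eliminate `p` and `q`.
  rw [(alternating_three_swap_continuous τ dYu w u).1] at h4
  rw [(alternating_three_swap_continuous τ w dXw u).1,
    (alternating_three_swap_continuous τ w u dXw).2,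
    (alternating_three_swap_continuous τ u w dXw).1] at h6
  simp only [inner_sub_left, inner_add_left, map_sub, h1, h2, h3, h4, h5, h6] at e1 e2 ⊢
  simp only [real_inner_comm dYu w, real_inner_comm dYw u, real_inner_comm dXu w,
    real_inner_comm dXw u, real_inner_comm u w] at e1 e2 ⊢
  linear_combination e2 - e1

/-! ### Comparison of the curvatures of D and D + A. -/

section CurvatureDifference

theorem finiteDimensional_tangentSpace {M : Type*} [TopologicalSpace M] [ChartedSpace E4 M]
    (x : M) : FiniteDimensional ℝ (TangentSpace (𝓡 4) x) :=
  inferInstanceAs (FiniteDimensional ℝ E4)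

variable {M : Type*} [TopologicalSpace M] [ChartedSpace E4 M] [IsManifold (𝓡 4) ∞ M]
  [RiemannianBundle (fun x : M => TangentSpace (𝓡 4) x)]

/-- Differentiability of a vector field at a point. -/
abbrev FieldDiffAt (X : (y : M) → TangentSpace (𝓡 4) y) (x : M) : Prop :=
  MDifferentiableAt (𝓡 4) (𝓡 4).tangent (fun y => (⟨y, X y⟩ : TangentBundle (𝓡 4) M)) x

/-- The curvature expression `D_X D_Y Z - D_Y D_X Z - D_{[X,Y]} Z` of vector fields. -/
def curvatureField (D : TangentConnection M) (X Y Z : (y : M) → TangentSpace (𝓡 4) y) (x : M) :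
    TangentSpace (𝓡 4) x :=
  D (fun y => D Z y (Y y)) x (X x) - D (fun y => D Z y (X y)) x (Y x)
    - D Z x (VectorField.mlieBracket (𝓡 4) X Y x)

attribute [local instance] finiteDimensional_tangentSpace

variable (D : TangentConnection M) (V : (x : M) → TangentSpace (𝓡 4) x)
  (T : (x : M) → TangentSpace (𝓡 4) x [⋀^Fin 3]→L[ℝ] ℝ)

theorem orthogonalConnection_apply (Z : (y : M) → TangentSpace (𝓡 4) y) (x : M)
    (w : TangentSpace (𝓡 4) x) :
    orthogonalConnection D V T Z x w = D Z x w + torsionTensor (V x) (T x) (Z x) w := rfl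

variable {D V T}

/-- A covariant derivative is additive only on sections differentiable at the point, so the two
summands of the inner derivative must each be known to be differentiable. -/
theorem orthogonalConnection_orthogonalConnection_apply {X Y Z : (y : M) → TangentSpace (𝓡 4) y}
    {x : M} (h1 : FieldDiffAt (fun y => D Z y (Y y)) x)
    (h2 : FieldDiffAt (fun y => torsionTensor (V y) (T y) (Z y) (Y y)) x) :
    orthogonalConnection D V T (fun y => orthogonalConnection D V T Z y (Y y)) x (X x) =
      D (fun y => D Z y (Y y)) x (X x)
        + D (fun y => torsionTensor (V y) (T y) (Z y) (Y y)) x (X x)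
        + torsionTensor (V x) (T x) (D Z x (Y x)) (X x)
        + torsionTensor (V x) (T x) (torsionTensor (V x) (T x) (Z x) (Y x)) (X x) := by
  rw [orthogonalConnection_apply]
  have h := D.isCovariantDerivativeOnUniv.add h1 h2
  have h' : D (fun y => orthogonalConnection D V T Z y (Y y)) x =
      D (fun y => D Z y (Y y)) x + D (fun y => torsionTensor (V y) (T y) (Z y) (Y y)) x := h
  rw [h', orthogonalConnection_apply, map_add]
  simp only [add_apply]
  abel

variable [IsContMDiffRiemannianBundle (𝓡 4) ∞ E4 (fun x : M => TangentSpace (𝓡 4) x)]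

theorem IsLeviCivita.mvfderiv_inner (hD : IsLeviCivita D) {X Y Z : (y : M) → TangentSpace (𝓡 4) y}
    {x : M} (hY : FieldDiffAt Y x) (hZ : FieldDiffAt Z x) :
    mvfderiv (𝓡 4) (fun y => inner ℝ (Y y) (Z y)) x (X x) =
      inner ℝ (D Y x (X x)) (Z x) + inner ℝ (Y x) (D Z x (X x)) := by
  have : IsContMDiffRiemannianBundle (𝓡 4) 1 E4 (fun x : M => TangentSpace (𝓡 4) x) :=
    IsContMDiffRiemannianBundle.of_le (n := ∞) (by norm_cast)
  exact hD.1.mvfderiv_inner_eq X hY hZ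

theorem IsLeviCivita.mlieBracket_eq (hD : IsLeviCivita D) {X Y : (y : M) → TangentSpace (𝓡 4) y}
    {x : M} (hX : FieldDiffAt X x) (hY : FieldDiffAt Y x) :
    VectorField.mlieBracket (𝓡 4) X Y x = D Y x (X x) - D X x (Y x) :=
  ((D.torsion_eq_zero_iff).1 hD.2 hX hY).symm

theorem mdifferentiableAt_inner {Y Z : (y : M) → TangentSpace (𝓡 4) y}
    {x : M} (hY : FieldDiffAt Y x) (hZ : FieldDiffAt Z x) :
    MDifferentiableAt (𝓡 4) 𝓘(ℝ, ℝ) (fun y => (inner ℝ (Y y) (Z y) : ℝ)) x := by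
  have : IsContMDiffRiemannianBundle (𝓡 4) 1 E4 (fun x : M => TangentSpace (𝓡 4) x) :=
    IsContMDiffRiemannianBundle.of_le (n := ∞) (by norm_cast)
  exact hY.inner_bundle hZ

/-- The derivative of `⟨A(Z)Y, X⟩` along `u`, where `T(Y, Z, X) = 0` identically. -/
theorem IsLeviCivita.mvfderiv_inner_torsionTensor (hD : IsLeviCivita D)
    {X Y Z U : (y : M) → TangentSpace (𝓡 4) y}
    {x : M} (hX : FieldDiffAt X x) (hY : FieldDiffAt Y x) (hZ : FieldDiffAt Z x)
    (hV : FieldDiffAt V x) (hT : ∀ y, T y ![Y y, Z y, X y] = 0) :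
    mvfderiv (𝓡 4) (fun y => inner ℝ (torsionTensor (V y) (T y) (Z y) (Y y)) (X y)) x (U x) =
      (inner ℝ (D Y x (U x)) (Z x) + inner ℝ (Y x) (D Z x (U x))) * inner ℝ (V x) (X x)
      + inner ℝ (Y x) (Z x) * (inner ℝ (D V x (U x)) (X x) + inner ℝ (V x) (D X x (U x)))
      - (inner ℝ (D V x (U x)) (Z x) + inner ℝ (V x) (D Z x (U x))) * inner ℝ (Y x) (X x)
      - inner ℝ (V x) (Z x) * (inner ℝ (D Y x (U x)) (X x) + inner ℝ (Y x) (D X x (U x))) := by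
  have hf : (fun y => (inner ℝ (torsionTensor (V y) (T y) (Z y) (Y y)) (X y) : ℝ)) =
      (fun y => inner ℝ (Y y) (Z y)) * (fun y => inner ℝ (V y) (X y))
        - (fun y => inner ℝ (V y) (Z y)) * (fun y => inner ℝ (Y y) (X y)) := by
    funext y
    rw [inner_torsionTensor, hT, add_zero]
    rfl
  have hYZ := mdifferentiableAt_inner hY hZ
  have hVX := mdifferentiableAt_inner hV hX
  have hVZ := mdifferentiableAt_inner hV hZ
  have hYX := mdifferentiableAt_inner hY hX
  rw [hf, mvfderiv_sub (hYZ.mul hVX) (hVZ.mul hYX), mvfderiv_mul hYZ hVX,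
    mvfderiv_mul hVZ hYX]
  simp only [sub_apply, add_apply,
    smul_apply, smul_eq_mul, hD.mvfderiv_inner hY hZ, hD.mvfderiv_inner hV hX,
    hD.mvfderiv_inner hV hZ, hD.mvfderiv_inner hY hX]
  ring

/-- Metric compatibility moves the derivative of A(Y)Y and A(Y)X onto the functions ⟨A(Y)Y, X⟩ and
⟨A(Y)X, X⟩, in which T vanishes identically; hence only derivatives of V survive. Vanishing torsion
of D replaces the Lie bracket by derivatives of X and Y, which cancel. -/
theorem IsLeviCivita.inner_curvatureField_difference (hD : IsLeviCivita D)
    {X Y : (y : M) → TangentSpace (𝓡 4) y}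
    {x : M} (hX : FieldDiffAt X x) (hY : FieldDiffAt Y x) (hV : FieldDiffAt V x)
    (h1 : FieldDiffAt (fun y => D Y y (Y y)) x) (h2 : FieldDiffAt (fun y => D Y y (X y)) x)
    (h3 : FieldDiffAt (fun y => torsionTensor (V y) (T y) (Y y) (Y y)) x)
    (h4 : FieldDiffAt (fun y => torsionTensor (V y) (T y) (Y y) (X y)) x) :
    inner ℝ (curvatureField (orthogonalConnection D V T) X Y Y x) (X x) =
      inner ℝ (curvatureField D X Y Y x) (X x) +
      (inner ℝ (Y x) (Y x) * inner ℝ (D V x (X x)) (X x)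
        - inner ℝ (D V x (X x)) (Y x) * inner ℝ (X x) (Y x)
        - inner ℝ (X x) (Y x) * inner ℝ (D V x (Y x)) (X x)
        + inner ℝ (D V x (Y x)) (Y x) * inner ℝ (X x) (X x)
        + inner ℝ (torsionTensor (V x) (T x) (torsionTensor (V x) (T x) (Y x) (Y x)) (X x)) (X x)
        - inner ℝ (torsionTensor (V x) (T x) (torsionTensor (V x) (T x) (Y x) (X x)) (Y x))
            (X x)) := by
  have e1 := hD.mvfderiv_inner (X := X) h3 hX
  have e2 := hD.mvfderiv_inner (X := Y) h4 hX
  rw [hD.mvfderiv_inner_torsionTensor hX hY hY hV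
    fun y => (alternating_three_self_continuous _ _ _).1] at e1
  rw [hD.mvfderiv_inner_torsionTensor hX hX hY hV
    fun y => (alternating_three_self_continuous _ _ _).2.2] at e2
  rw [curvatureField, curvatureField, orthogonalConnection_orthogonalConnection_apply h1 h3,
    orthogonalConnection_orthogonalConnection_apply h2 h4, orthogonalConnection_apply,
    hD.mlieBracket_eq hX hY]
  exact curvature_difference_algebra _ _ _ _ _ _ _ _ _ _ _ _ _ _ _ e1 e2

end CurvatureDifference

/-! ### Differentiability of brackets, directional derivatives and values of forms. -/

section Regularity

variable {M : Type*} [TopologicalSpace M] [ChartedSpace E4 M] 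

open Topology Filter

/-- Currying one slot at a time reduces multilinear evaluation to three evaluations of a continuous
linear map. -/
theorem MDifferentiableAt.alternating_three_apply {α : M → E4 [⋀^Fin 3]→L[ℝ] ℝ} {a c d : M → E4}
    {x : M} (hα : MDifferentiableAt (𝓡 4) 𝓘(ℝ, E4 [⋀^Fin 3]→L[ℝ] ℝ) α x)
    (ha : MDifferentiableAt (𝓡 4) 𝓘(ℝ, E4) a x) (hc : MDifferentiableAt (𝓡 4) 𝓘(ℝ, E4) c x)
    (hd : MDifferentiableAt (𝓡 4) 𝓘(ℝ, E4) d x) :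
    MDifferentiableAt (𝓡 4) 𝓘(ℝ, ℝ) (fun y => α y ![a y, c y, d y]) x := by
  let L3 : (E4 [⋀^Fin 3]→L[ℝ] ℝ) →L[ℝ] (E4 →L[ℝ] E4 [×2]→L[ℝ] ℝ) :=
    ((continuousMultilinearCurryLeftEquiv ℝ (fun _ : Fin 3 => E4) ℝ).toContinuousLinearEquiv
      |>.toContinuousLinearMap) ∘L ContinuousAlternatingMap.toContinuousMultilinearMapCLM ℝ
  let L2 : (E4 [×2]→L[ℝ] ℝ) →L[ℝ] (E4 →L[ℝ] E4 [×1]→L[ℝ] ℝ) :=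
    (continuousMultilinearCurryLeftEquiv ℝ (fun _ : Fin 2 => E4) ℝ).toContinuousLinearEquiv
      |>.toContinuousLinearMap
  let L1 : (E4 [×1]→L[ℝ] ℝ) →L[ℝ] (E4 →L[ℝ] E4 [×0]→L[ℝ] ℝ) :=
    (continuousMultilinearCurryLeftEquiv ℝ (fun _ : Fin 1 => E4) ℝ).toContinuousLinearEquiv
      |>.toContinuousLinearMap
  let L0 : (E4 [×0]→L[ℝ] ℝ) →L[ℝ] ℝ :=
    (continuousMultilinearCurryFin0 ℝ E4 ℝ).toContinuousLinearEquiv.toContinuousLinearMap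
  have h1 := (L3.mdifferentiableAt.comp x hα).clm_apply ha
  have h2 := (L2.mdifferentiableAt.comp x h1).clm_apply hc
  have h3 := (L1.mdifferentiableAt.comp x h2).clm_apply hd
  refine (L0.mdifferentiableAt.comp x h3).congr_of_eventuallyEq (Eventually.of_forall fun y => ?_)
  change α y ![a y, c y, d y] = α y _
  congr 1
  ext i
  fin_cases i <;> rfl

theorem IsSmoothForm.const_smul {k : ℕ} {T : (x : M) → TangentSpace (𝓡 4) x [⋀^Fin k]→L[ℝ] ℝ}
    (hT : IsSmoothForm T) (c : ℝ) : IsSmoothForm (fun x => c • T x) := fun p =>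
  (contDiffOn_const (c := c)).smul (hT p)

variable [IsManifold (𝓡 4) ∞ M]

theorem isManifold_two : IsManifold (𝓡 4) 2 M := IsManifold.of_le (n := ∞) (by norm_cast)

theorem isManifold_three : IsManifold (𝓡 4) 3 M := IsManifold.of_le (n := ∞) (by norm_cast)

attribute [local instance] isManifold_two isManifold_three

/-- Near x the differential of the chart at x is the fibre coordinate of the tangent bundle
trivialization, so this is the coordinate expression of the field. -/
theorem FieldDiffAt.mfderiv_extChartAt {X : (y : M) → TangentSpace (𝓡 4) y} {x : M}
    (hX : FieldDiffAt X x) :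
    MDifferentiableAt (𝓡 4) 𝓘(ℝ, E4)
      (fun y => (mfderiv (𝓡 4) 𝓘(ℝ, E4) (extChartAt (𝓡 4) x) y (X y) : E4)) x := by
  have h := (mdifferentiableAt_section (F := E4) (IB := 𝓡 4) X).1 hX
  refine h.congr_of_eventuallyEq ?_
  filter_upwards [chart_source_mem_nhds E4 x] with y hy
  rw [← TangentBundle.continuousLinearMapAt_trivializationAt hy]
  exact (Trivialization.continuousLinearMapAt_apply_of_mem ℝ
    (trivializationAt E4 (TangentSpace (𝓡 4)) x) (by simpa using hy) (X y))

/-- The Koszul formula will be differentiated, so it must hold on a neighbourhood and not only at x.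
-/
theorem eventually_fieldDiffAt {X : (y : M) → TangentSpace (𝓡 4) y} {x : M}
    (hX : ContMDiffAt (𝓡 4) (𝓡 4).tangent 2 (fun y => (⟨y, X y⟩ : TangentBundle (𝓡 4) M)) x) :
    ∀ᶠ y in 𝓝 x, FieldDiffAt X y := by
  have h1 := hX.of_le (m := 1) (by norm_num)
  exact ((contMDiffAt_iff_contMDiffAt_nhds (by simp)).1 h1).mono fun y hy =>
    hy.mdifferentiableAt one_ne_zero

theorem fieldDiffAt_mlieBracket {X Y : (y : M) → TangentSpace (𝓡 4) y} {x : M}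
    (hX : ContMDiffAt (𝓡 4) (𝓡 4).tangent 2 (fun y => (⟨y, X y⟩ : TangentBundle (𝓡 4) M)) x)
    (hY : ContMDiffAt (𝓡 4) (𝓡 4).tangent 2 (fun y => (⟨y, Y y⟩ : TangentBundle (𝓡 4) M)) x) :
    FieldDiffAt (VectorField.mlieBracket (𝓡 4) X Y) x := by
  have : IsManifold (𝓡 4) (((2 : ℕ∞) : ℕ∞ω) + 1) M := IsManifold.of_le (n := ∞) (by norm_cast)
  have : IsManifold (𝓡 4) (minSmoothness ℝ 2) M := by
    rw [minSmoothness_of_isRCLikeNormedField]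
    infer_instance
  exact (ContMDiffAt.mlieBracket_vectorField (m := 1) (n := 2) hX hY
    (by simp; norm_num)).mdifferentiableAt one_ne_zero

/-- In the chart at x the function is the ordinary derivative of g applied to the coordinates of X.
The derivative of a C² function is differentiable, and the chain rule identifies both expressions
throughout a neighbourhood. -/
theorem mdifferentiableAt_mvfderiv_apply {g : M → ℝ} {x : M}
    (hg : ContMDiffAt (𝓡 4) 𝓘(ℝ, ℝ) 2 g x)
    {X : (y : M) → TangentSpace (𝓡 4) y} (hX : FieldDiffAt X x) :
    MDifferentiableAt (𝓡 4) 𝓘(ℝ, ℝ) (fun y => mvfderiv (𝓡 4) g y (X y)) x := by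
  set φ := extChartAt (𝓡 4) x with hφ
  have hg' : ContDiffAt ℝ 2 (g ∘ φ.symm) (φ x) := by
    have := (contMDiffAt_iff.1 hg).2
    rw [ModelWithCorners.range_eq_univ, contDiffWithinAt_univ] at this
    exact this
  have h1 : DifferentiableAt ℝ (fderiv ℝ (g ∘ φ.symm)) (φ x) :=
    (hg'.fderiv_right (m := 1) (by norm_num)).differentiableAt one_ne_zero
  have h2 : MDifferentiableAt (𝓡 4) 𝓘(ℝ, E4 →L[ℝ] ℝ) (fun y => fderiv ℝ (g ∘ φ.symm) (φ y)) x :=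
    h1.mdifferentiableAt.comp x (mdifferentiableAt_extChartAt (mem_chart_source E4 x))
  refine (h2.clm_apply hX.mfderiv_extChartAt).congr_of_eventuallyEq ?_
  have hd : ∀ᶠ z in 𝓝 (φ x), DifferentiableAt ℝ (g ∘ φ.symm) z :=
    (hg'.eventually (by norm_num)).mono fun z hz => hz.differentiableAt two_ne_zero
  filter_upwards [chart_source_mem_nhds E4 x,
    (continuousAt_extChartAt (I := 𝓡 4) x).eventually hd] with y hy hyd
  have hgy : g =ᶠ[𝓝 y] (g ∘ φ.symm) ∘ φ := by
    filter_upwards [(isOpen_extChartAt_source (I := 𝓡 4) x).mem_nhds (by simpa using hy)]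
      with z hz
    exact congrArg g ((extChartAt (𝓡 4) x).left_inv hz).symm
  have hc : HasMFDerivAt (𝓡 4) 𝓘(ℝ, ℝ) g y
      ((fderiv ℝ (g ∘ φ.symm) (φ y)).comp (mfderiv (𝓡 4) 𝓘(ℝ, E4) φ y)) :=
    (hyd.hasFDerivAt.hasMFDerivAt.comp y
      (mdifferentiableAt_extChartAt hy).hasMFDerivAt).congr_of_eventuallyEq hgy
  change mfderiv (𝓡 4) 𝓘(ℝ, ℝ) g y (X y) = _
  rw [hc.mfderiv]
  rfl

/-- In the chart at `p`, a differential form is evaluated on the images of tangent vectors. -/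
theorem formInChart_apply {k : ℕ} (T : (x : M) → TangentSpace (𝓡 4) x [⋀^Fin k]→L[ℝ] ℝ) (p : M)
    {z : E4} (hz : z ∈ (extChartAt (𝓡 4) p).target) {y : M}
    (hy : y = (extChartAt (𝓡 4) p).symm z) (v : Fin k → TangentSpace (𝓡 4) y) :
    formInChart T p z (fun i => mfderiv (𝓡 4) 𝓘(ℝ, E4) (extChartAt (𝓡 4) p) y (v i)) = T y v := by
  subst hy
  have h := mfderivWithin_extChartAt_symm_comp_mfderiv_extChartAt (I := 𝓡 4) hz
  rw [ModelWithCorners.range_eq_univ, mfderivWithin_univ] at h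
  change T _ _ = _
  congr 1
  funext i
  exact congrArg (fun L => L (v i)) h

theorem mdifferentiableAt_form_apply {T : (x : M) → TangentSpace (𝓡 4) x [⋀^Fin 3]→L[ℝ] ℝ}
    (hT : IsSmoothForm T) {X Y Z : (y : M) → TangentSpace (𝓡 4) y} {x : M}
    (hX : FieldDiffAt X x) (hY : FieldDiffAt Y x) (hZ : FieldDiffAt Z x) :
    MDifferentiableAt (𝓡 4) 𝓘(ℝ, ℝ) (fun y => T y ![X y, Y y, Z y]) x := by
  have hα : DifferentiableAt ℝ (formInChart T x) (extChartAt (𝓡 4) x x) :=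
    ((hT x).contDiffAt ((isOpen_extChartAt_target x).mem_nhds
      (mem_extChartAt_target x))).differentiableAt (by simp)
  have h := (hα.mdifferentiableAt.comp x
    (mdifferentiableAt_extChartAt (I := 𝓡 4) (mem_chart_source E4 x))).alternating_three_apply
    hX.mfderiv_extChartAt hY.mfderiv_extChartAt hZ.mfderiv_extChartAt
  refine h.congr_of_eventuallyEq ?_
  filter_upwards [extChartAt_source_mem_nhds (I := 𝓡 4) x] with y hy
  rw [← formInChart_apply T x ((extChartAt (𝓡 4) x).map_source hy)
    ((extChartAt (𝓡 4) x).left_inv hy).symm]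
  congr 1
  ext i : 1
  fin_cases i <;> rfl

variable [RiemannianBundle (fun x : M => TangentSpace (𝓡 4) x)]
  {ι : Type*} (S : SpinStructure M ι)

theorem SpinStructure.contMDiffAt_frame (x : M) (a : Fin 4) :
    ContMDiffAt (𝓡 4) (𝓡 4).tangent ∞
      (fun y => (⟨y, S.frame (S.indexAt x) a y⟩ : TangentBundle (𝓡 4) M)) x :=
  (S.smooth_frame _ a).contMDiffAt ((S.isOpen_baseSet _).mem_nhds (S.mem_baseSet_at x))

theorem SpinStructure.sum_inner_frame {i : ι} {y : M} (hy : y ∈ S.baseSet i)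
    (w : TangentSpace (𝓡 4) y) :
    ∑ a, (inner ℝ (S.frame i a y) w : ℝ) • S.frame i a y = w := by
  have h : Module.finrank ℝ (TangentSpace (𝓡 4) y) = 4 :=
    (finrank_euclideanSpace_fin : Module.finrank ℝ E4 = 4)
  have ho := S.orthonormal_frame i y hy
  have := (OrthonormalBasis.mk ho
    (ho.linearIndependent.span_eq_top_of_card_eq_finrank (by simp [h])).ge).sum_repr' w
  simpa using this

/-- A vector field is differentiable if its coefficients in the frame are. -/
theorem SpinStructure.fieldDiffAt_of_inner_frame {W : (y : M) → TangentSpace (𝓡 4) y} {x : M}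
    (h : ∀ a, MDifferentiableAt (𝓡 4) 𝓘(ℝ, ℝ)
      (fun y => (inner ℝ (W y) (S.frame (S.indexAt x) a y) : ℝ)) x) : FieldDiffAt W x := by
  have hs : FieldDiffAt (fun y => ∑ a, ((fun y => (inner ℝ (W y) (S.frame (S.indexAt x) a y) : ℝ))
      • S.frame (S.indexAt x) a) y) x :=
    MDifferentiableAt.sum_section fun a _ =>
      (h a).smul_section ((S.contMDiffAt_frame x a).mdifferentiableAt (by simp))
  refine hs.congr_of_eventuallyEq ?_
  filter_upwards [(S.isOpen_baseSet _).mem_nhds (S.mem_baseSet_at x)] with y hy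
  have := S.sum_inner_frame hy (W y)
  simp only [real_inner_comm] at this
  simp only [Pi.smul_apply', this]

end Regularity

/-! ### The Koszul formula, regularity of the Levi-Civita connection, and the scalar curvature of D
+ A. -/

section Koszul

open Topology Filter

attribute [local instance] finiteDimensional_tangentSpace isManifold_two isManifold_three

variable {M : Type*} [TopologicalSpace M] [ChartedSpace E4 M] [IsManifold (𝓡 4) ∞ M]
  [RiemannianBundle (fun x : M => TangentSpace (𝓡 4) x)]
  [IsContMDiffRiemannianBundle (𝓡 4) ∞ E4 (fun x : M => TangentSpace (𝓡 4) x)]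
  {D : TangentConnection M}

/-- The Koszul formula. -/
theorem IsLeviCivita.koszul (hD : IsLeviCivita D) {X Y Z : (y : M) → TangentSpace (𝓡 4) y} {x : M}
    (hX : FieldDiffAt X x) (hY : FieldDiffAt Y x) (hZ : FieldDiffAt Z x) :
    inner ℝ (D Y x (X x)) (Z x) = 1 / 2 *
      (mvfderiv (𝓡 4) (fun y => inner ℝ (Y y) (Z y)) x (X x)
        + mvfderiv (𝓡 4) (fun y => inner ℝ (X y) (Z y)) x (Y x)
        - mvfderiv (𝓡 4) (fun y => inner ℝ (X y) (Y y)) x (Z x)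
        + inner ℝ (VectorField.mlieBracket (𝓡 4) X Y x) (Z x)
        - inner ℝ (VectorField.mlieBracket (𝓡 4) X Z x) (Y x)
        - inner ℝ (VectorField.mlieBracket (𝓡 4) Y Z x) (X x)) := by
  rw [hD.mvfderiv_inner hY hZ, hD.mvfderiv_inner hX hZ, hD.mvfderiv_inner hX hY,
    hD.mlieBracket_eq hX hY, hD.mlieBracket_eq hX hZ, hD.mlieBracket_eq hY hZ]
  simp only [inner_sub_left]
  rw [real_inner_comm _ (Y x), real_inner_comm _ (X x), real_inner_comm _ (X x)]
  ring

theorem contMDiffAt_inner {X Y : (y : M) → TangentSpace (𝓡 4) y} {x : M}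
    (hX : ContMDiffAt (𝓡 4) (𝓡 4).tangent 2 (fun y => (⟨y, X y⟩ : TangentBundle (𝓡 4) M)) x)
    (hY : ContMDiffAt (𝓡 4) (𝓡 4).tangent 2 (fun y => (⟨y, Y y⟩ : TangentBundle (𝓡 4) M)) x) :
    ContMDiffAt (𝓡 4) 𝓘(ℝ, ℝ) 2 (fun y => (inner ℝ (X y) (Y y) : ℝ)) x := by
  have : IsContMDiffRiemannianBundle (𝓡 4) 2 E4 (fun x : M => TangentSpace (𝓡 4) x) :=
    IsContMDiffRiemannianBundle.of_le (n := ∞) (by norm_cast)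
  exact hX.inner_bundle hY

/-- Regularity of D is a consequence of being Levi-Civita: paired with a smooth local orthonormal
frame, D_X Y is a Koszul expression in first derivatives of inner products and in brackets, all
differentiable when X and Y are C². -/
theorem IsLeviCivita.fieldDiffAt (hD : IsLeviCivita D) {ι : Type*} (S : SpinStructure M ι)
    {X Y : (y : M) → TangentSpace (𝓡 4) y} {x : M}
    (hX : ContMDiffAt (𝓡 4) (𝓡 4).tangent 2 (fun y => (⟨y, X y⟩ : TangentBundle (𝓡 4) M)) x)
    (hY : ContMDiffAt (𝓡 4) (𝓡 4).tangent 2 (fun y => (⟨y, Y y⟩ : TangentBundle (𝓡 4) M)) x) :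
    FieldDiffAt (fun y => D Y y (X y)) x := by
  refine S.fieldDiffAt_of_inner_frame fun a => ?_
  have hZ := (S.contMDiffAt_frame x a).of_le (m := 2) (by norm_cast)
  have hX' := hX.mdifferentiableAt two_ne_zero
  have hY' := hY.mdifferentiableAt two_ne_zero
  have hZ' := hZ.mdifferentiableAt two_ne_zero
  have h := ((((((mdifferentiableAt_mvfderiv_apply (contMDiffAt_inner hY hZ) hX').add
    (mdifferentiableAt_mvfderiv_apply (contMDiffAt_inner hX hZ) hY')).sub
    (mdifferentiableAt_mvfderiv_apply (contMDiffAt_inner hX hY) hZ')).add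
    (mdifferentiableAt_inner (fieldDiffAt_mlieBracket hX hY) hZ')).sub
    (mdifferentiableAt_inner (fieldDiffAt_mlieBracket hX hZ) hY')).sub
    (mdifferentiableAt_inner (fieldDiffAt_mlieBracket hY hZ) hX')).const_smul (1 / 2 : ℝ)
  refine h.congr_of_eventuallyEq ?_
  filter_upwards [eventually_fieldDiffAt hX, eventually_fieldDiffAt hY, eventually_fieldDiffAt hZ]
    with y h1 h2 h3
  rw [hD.koszul h1 h2 h3]
  rfl

theorem fieldDiffAt_torsionTensor {ι : Type*} (S : SpinStructure M ι)
    {V : (y : M) → TangentSpace (𝓡 4) y}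
    {T : (x : M) → TangentSpace (𝓡 4) x [⋀^Fin 3]→L[ℝ] ℝ} (hT : IsSmoothForm T)
    {X Y : (y : M) → TangentSpace (𝓡 4) y} {x : M} (hV : FieldDiffAt V x) (hX : FieldDiffAt X x)
    (hY : FieldDiffAt Y x) :
    FieldDiffAt (fun y => torsionTensor (V y) (T y) (Y y) (X y)) x := by
  refine S.fieldDiffAt_of_inner_frame fun a => ?_
  have hZ := (S.contMDiffAt_frame x a).mdifferentiableAt (by simp)
  refine ((((mdifferentiableAt_inner hX hY).mul (mdifferentiableAt_inner hV hZ)).sub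
    ((mdifferentiableAt_inner hV hY).mul (mdifferentiableAt_inner hX hZ))).add
    (mdifferentiableAt_form_apply hT hX hY hZ)).congr_of_eventuallyEq
    (Eventually.of_forall fun y => ?_)
  exact inner_torsionTensor _ _ _ _ _

/-- The scalar curvature of the connection `D + A` with vectorial torsion `V` and totally
antisymmetric torsion `T`. -/
theorem IsLeviCivita.scalarCurvature_orthogonalConnection (hD : IsLeviCivita D)
    {ι : Type*} (S : SpinStructure M ι)
    {V : (x : M) → TangentSpace (𝓡 4) x} (hV : IsSmoothVectorField V)
    {T : (x : M) → TangentSpace (𝓡 4) x [⋀^Fin 3]→L[ℝ] ℝ} (hT : IsSmoothForm T) (x : M)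
    (b : OrthonormalBasis (Fin 4) ℝ (TangentSpace (𝓡 4) x)) :
    scalarCurvature (orthogonalConnection D V T) x b = scalarCurvature D x b
      + 6 * divergence D V x b - 6 * inner ℝ (V x) (V x)
      - tensorInner b (T x).toAlternatingMap (T x).toAlternatingMap := by
  have hV' : FieldDiffAt V x := (hV x).mdifferentiableAt (by simp)
  have key (i j : Fin 4) := by
    have hX (i : Fin 4) : ContMDiffAt (𝓡 4) (𝓡 4).tangent 2 (fun y =>
        (⟨y, (FiberBundle.extend E4 (b i) : (y : M) → TangentSpace (𝓡 4) y) y⟩ :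
          TangentBundle (𝓡 4) M)) x :=
      FiberBundle.contMDiffAt_extend (𝓡 4) E4 (b i)
    have hX' (i : Fin 4) := (hX i).mdifferentiableAt two_ne_zero
    exact hD.inner_curvatureField_difference (hX' i) (hX' j) hV' (hD.fieldDiffAt S (hX j) (hX j))
      (hD.fieldDiffAt S (hX i) (hX j)) (fieldDiffAt_torsionTensor S hT hV' (hX' j) (hX' j))
      (fieldDiffAt_torsionTensor S hT hV' (hX' i) (hX' j))
  -- At x the extensions take the values of the basis vectors; their derivatives no longer occur in
  -- the difference term.
  simp only [FiberBundle.extend_apply_self] at key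
  have hsum := sum_curvature_difference b (V x) (T x) (fun w => D V x w)
  rw [scalarCurvature, scalarCurvature, divergence]
  have key' (i j : Fin 4) : inner ℝ (riemann (orthogonalConnection D V T) x (b i) (b j) (b j)) (b i)
      = inner ℝ (riemann D x (b i) (b j) (b j)) (b i) + _ := key i j
  simp only [key', Finset.sum_add_distrib, Finset.sum_sub_distrib] at hsum ⊢
  linarith

end Koszul

/-! ### Geometric meaning of the two coefficients of the potential. -/

section Traces

variable {M : Type*} [TopologicalSpace M] [ChartedSpace E4 M] [IsManifold (𝓡 4) ∞ M]
  [RiemannianBundle (fun x : M => TangentSpace (𝓡 4) x)]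
  {ι : Type*} (S : SpinStructure M ι)

theorem tensorInner_smul_smul {W : Type*} [NormedAddCommGroup W] [InnerProductSpace ℝ W]
    (b : OrthonormalBasis (Fin 4) ℝ W) {k : ℕ} (P : W [⋀^Fin k]→L[ℝ] ℝ) (c : ℝ) :
    tensorInner b (c • P).toAlternatingMap (c • P).toAlternatingMap =
      c ^ 2 * tensorInner b P.toAlternatingMap P.toAlternatingMap := by
  rw [tensorInner, tensorInner, Finset.mul_sum]
  refine Finset.sum_congr rfl fun i _ => ?_
  simp only [ContinuousAlternatingMap.coe_toAlternatingMap, ContinuousAlternatingMap.smul_apply,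
    smul_eq_mul]
  ring

/-- `4 c²` for the coefficient `c` of the volume element in the potential. -/
theorem SpinStructure.four_mul_potentialPseudoscalar_sq (V : (x : M) → TangentSpace (𝓡 4) x)
    (T : (x : M) → TangentSpace (𝓡 4) x [⋀^Fin 3]→L[ℝ] ℝ) (x : M) :
    4 * S.potentialPseudoscalar V T x ^ 2 =
      3 / 8 * tensorInner (S.frameBasis x) (exteriorDerivative T x).toAlternatingMap
          (exteriorDerivative T x).toAlternatingMap
        - 162 * tensorInner (S.frameBasis x) (interiorProd (V x) (T x).toAlternatingMap)
          (interiorProd (V x) (T x).toAlternatingMap)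
        + 54 * inner ℝ (V x) (V x) *
          tensorInner (S.frameBasis x) (T x).toAlternatingMap (T x).toAlternatingMap
        - 18 * tensorInner (S.frameBasis x)
          (interiorProd (V x) (exteriorDerivative T x).toAlternatingMap)
          (T x).toAlternatingMap := by
  -- With d = dT(e₀, e₁, e₂, e₃) and w = `wedgeFlat`, both sides equal 9d² + 108dw + 324w²; the
  -- |V|²‖T‖² terms cancel because 162/3 = 54.
  rw [tensorInner_four, tensorInner_interiorProd_three_self, tensorInner_interiorProd_four,
    potentialPseudoscalar]
  simp only [ContinuousAlternatingMap.coe_toAlternatingMap]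
  ring

/-- The Holst term is (18d + 108w) ω = -12c ω, and ‖ω‖² = 4! = 24 as a tensor, whence 288. -/
theorem SpinStructure.tensorInner_holstTerm_vol (V : (x : M) → TangentSpace (𝓡 4) x)
    (T : (x : M) → TangentSpace (𝓡 4) x [⋀^Fin 3]→L[ℝ] ℝ) (x : M) :
    tensorInner (S.frameBasis x) (S.holstTerm V T x) (S.vol x) =
      -(288 * S.potentialPseudoscalar V T x) := by
  have h := tensorInner_hodgeOneForm_flat (S.frameBasis x) (T x).toAlternatingMap (V x)
  rw [tensorInner_four, vol, volForm_basis, potentialPseudoscalar, holstTerm]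
  simp only [AlternatingMap.sub_apply, AlternatingMap.smul_apply, vol, volForm_basis, smul_eq_mul]
  simp only [ContinuousAlternatingMap.coe_toAlternatingMap] at h ⊢
  rw [h]
  ring

/-- The curvature formula for 3V and 3T reads R̃ = R + 18 div V - 54|V|² - 9‖T‖², and -(2R + R̃)/3
is then four times the scalar part of the potential. -/
theorem IsLeviCivita.four_mul_potentialScalar
    [IsContMDiffRiemannianBundle (𝓡 4) ∞ E4 (fun x : M => TangentSpace (𝓡 4) x)]
    {D : TangentConnection M} (hD : IsLeviCivita D)
    {V : (x : M) → TangentSpace (𝓡 4) x} (hV : IsSmoothVectorField V)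
    {T : (x : M) → TangentSpace (𝓡 4) x [⋀^Fin 3]→L[ℝ] ℝ} (hT : IsSmoothForm T) (x : M) :
    4 * S.potentialScalar D V T x = -(2 / 3) * scalarCurvature D x (S.frameBasis x)
      - 1 / 3 * scalarCurvature (modifiedConnection D V T) x (S.frameBasis x) := by
  have hdiv : divergence D (fun x => (3 : ℝ) • V x) x (S.frameBasis x) =
      3 * divergence D V x (S.frameBasis x) := by
    have h : D (fun x => (3 : ℝ) • V x) x = (3 : ℝ) • D V x :=
      D.isCovariantDerivativeOnUniv.smul_const 3 ((hV x).mdifferentiableAt (by simp))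
    rw [divergence, divergence, Finset.mul_sum, h]
    refine Finset.sum_congr rfl fun i _ => ?_
    rw [smul_apply, real_inner_smul_left]
  have h3V : IsSmoothVectorField (fun x => (3 : ℝ) • V x) :=
    ContMDiff.smul_section (f := fun _ => (3 : ℝ)) contMDiff_const hV
  rw [modifiedConnection, hD.scalarCurvature_orthogonalConnection S h3V (hT.const_smul 3), hdiv,
    tensorInner_smul_smul, real_inner_smul_left, real_inner_smul_right,
    SpinStructure.potentialScalar]
  ring

end Traces

theorem mainTheorem10
    {M : Type*} [TopologicalSpace M] [ChartedSpace E4 M] [IsManifold (𝓡 4) ∞ M]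
    [RiemannianBundle (fun x : M => TangentSpace (𝓡 4) x)]
    [IsContMDiffRiemannianBundle (𝓡 4) ∞ E4 (fun x : M => TangentSpace (𝓡 4) x)]
    {ι : Type*} (S : SpinStructure M ι)
    (D : TangentConnection M) (hD : IsLeviCivita D)
    (V : (x : M) → TangentSpace (𝓡 4) x) (hV : IsSmoothVectorField V)
    (T : (x : M) → TangentSpace (𝓡 4) x [⋀^Fin 3]→L[ℝ] ℝ) (hT : IsSmoothForm T)
    (x : M) :
    let b := S.frameBasis x
    let τ := (T x).toAlternatingMap
    let dτ := (exteriorDerivative T x).toAlternatingMap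
    let E := S.potential D V T x
    let Ω := S.cliffordForm (S.vol x)
    let R := scalarCurvature D x b
    let Rmod := scalarCurvature (modifiedConnection D V T) x b
    let C := S.holstTerm V T x
    LinearMap.trace ℂ (S.Spinors x) E = ((-(2 / 3) * R - 1 / 3 * Rmod : ℝ) : ℂ) ∧
    LinearMap.trace ℂ (S.Spinors x) (E ^ 2) =
      ((1 / 36 * (2 * R + Rmod) ^ 2 + 3 / 8 * tensorInner b dτ dτ
        - 162 * tensorInner b (interiorProd (V x) τ) (interiorProd (V x) τ)
        + 54 * inner ℝ (V x) (V x) * tensorInner b τ τ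
        - 18 * tensorInner b (interiorProd (V x) dτ) τ : ℝ) : ℂ) ∧
    LinearMap.trace ℂ (S.Spinors x) (E * Ω) =
      ((-(1 / 72) * tensorInner b C (S.vol x) : ℝ) : ℂ) ∧
    LinearMap.trace ℂ (S.Spinors x) (E ^ 2 * Ω) =
      ((1 / 432 * (2 * R + Rmod) * tensorInner b C (S.vol x) : ℝ) : ℂ) := by

  intro b τ dτ E Ω R Rmod C
  obtain ⟨h1, h2, h3, h4⟩ := S.trace_potential D V T x
  have hf := hD.four_mul_potentialScalar S hV hT x
  have hc := S.four_mul_potentialPseudoscalar_sq V T x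
  have hC := S.tensorInner_holstTerm_vol V T x
  set f := S.potentialScalar D V T x
  set c := S.potentialPseudoscalar V T x
  -- Together with ⟨C, ω⟩ = -288c this fixes all constants: 12²/36 = 4, 288/72 = 4 and 12 · 288/432
  -- = 8.
  have hR : 2 * R + Rmod = -(12 * f) := by linarith
  refine ⟨h1.trans ?_, h2.trans ?_, h3.trans ?_, h4.trans ?_⟩
  · rw [hf]
  · rw [hR, mul_add, hc]
    congr 1
    ring
  · rw [hC]
    congr 1
    ring
  · rw [hR, hC]
    congr 1
    ring

end
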